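/- Let $(\Omega,\mathcal F,\mathbb P)$ be a probability space, $(\mathcal F_t)_{t\in[0,T]}$ a filtration, $S=(S_t)_{t\in[0,T]}$ a real-valued $(\mathcal F_t)$-adapted price process, $(\mathcal G_t)_{t\in[0,T]}$ a filtration with $\mathcal G_t\subseteq\mathcal F_t$ for all $t$ (the investor's information), $F$ a real random variable and $\lambda>0$. Fix trading times $\mathbb T=\{0=t_0<t_1<\dots<t_N\le T\}$. Let $\mathcal A(\mathbb T)$ be the set of all $\gamma=(\gamma_{t_1},\dots,\gamma_{t_N})$ such that each $\gamma_{t_i}$ is a real-valued $\mathcal G_{t_{i-1}}$-measurable random variable (the position held on $(t_{i-1},t_i]$), and put $V^\gamma_T=\sum_{i=1}^N\gamma_{t_i}(S_{t_i}-S_{t_{i-1}})$. Let $\mathcal Q(\mathbb T)$ be the set of probability measures $\mathbb Q\sim\mathbb P$ with finite relative entropy $\mathbb E_{\mathbb Q}[\log\frac{d\mathbb Q}{d\mathbb P}]<\infty$ such that $S_u\in L^1(\mathbb Q)$ for all $u\in\mathbb T$ and $$\mathbb E_{\mathbb Q}[S_t-S_s\mid\mathcal G_s]=0\quad\text{for all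 } s,t\in\mathbb T \text{ with } s\le t .$$ Suppose that there is $\epsilon>0$ such that $\mathbb E_{\mathbb P}[\exp(\lambda(1+\epsilon)|F|)]<\infty$ and $\mathbb E_{\mathbb P}[\exp(\epsilon|S_t|^{1+\epsilon})]<\infty$ for all $t\in\mathbb T$, and that $\mathcal Q(\mathbb T)\neq\emptyset$. Then $F-\frac1\lambda\log\frac{d\mathbb Q}{d\mathbb P}$ is $\mathbb Q$-integrable for every $\mathbb Q\in\mathcal Q(\mathbb T)$, $$\inf_{\gamma\in\mathcal A(\mathbb T)}\frac1\lambda\log\mathbb E_{\mathbb P}\left[\exp\left(-\lambda(V^\gamma_T-F)\right)\right]=\sup_{\mathbb Q\in\mathcal Q(\mathbb T)}\mathbb E_{\mathbb Q}\left[F-\frac1\lambda\log\frac{d\mathbb Q}{d\mathbb P}\right],$$ where the expectation on the left may be $+\infty$ for some $\gamma$ (with $\log(+\infty)=+\infty$), and the supremum is attained by some $\mathbb Q_0\in\mathcal Q(\mathbb T)$. -/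

import Mathlib

open MeasureTheory ProbabilityTheory

namespace DelayedDuality

variable {Ω : Type*} {m : MeasurableSpace Ω} {T : ℝ} {N : ℕ}

/-- The trading strategies that are predictable for the investor's filtration `𝓖` and trade only at
the times `t 0 < t 1 < … < t N`. The position `γ i` is the one held on the interval
`(t i, t (i + 1)]`; it is chosen at the time `t i`, hence `𝓖 (t i)`-measurable. No boundedness or
integrability is imposed. -/
def strategies (𝓖 : Filtration (Set.Icc (0 : ℝ) T) m) (t : Fin (N + 1) → Set.Icc (0 : ℝ) T) :
    Set (Fin N → Ω → ℝ) :=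
  {γ | ∀ i : Fin N, Measurable[𝓖 (t i.castSucc)] (γ i)}

/-- The terminal profit and loss `∑ i, γ i * (S_{t (i + 1)} - S_{t i})` of a strategy. -/
def terminalPnL (S : Set.Icc (0 : ℝ) T → Ω → ℝ) (t : Fin (N + 1) → Set.Icc (0 : ℝ) T)
    (γ : Fin N → Ω → ℝ) (ω : Ω) : ℝ :=
  ∑ i : Fin N, γ i ω * (S (t i.succ) ω - S (t i.castSucc) ω)

/-- The certainty equivalent `(1 / λ) log E_P[exp (-λ (V - F))]`, as an extended real: the
expectation of the nonnegative variable `exp (-λ (V - F))` may be infinite, and then the value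
is `⊤`. -/
noncomputable def certaintyEquivalent (P : Measure Ω) (lam : ℝ) (V F : Ω → ℝ) : EReal :=
  ((1 / lam : ℝ) : EReal) *
    ENNReal.log (∫⁻ ω, ENNReal.ofReal (Real.exp (-lam * (V ω - F ω))) ∂P)

/-- The relaxed martingale property at the times `t 0, …, t N`: each `S_{t i}` is `Q`-integrable,
and `E_Q[S_{t j} - S_{t i} | 𝓖_{t i}] = 0` for `i ≤ j`. -/
def RelaxedMartingale (Q : Measure Ω) (𝓖 : Filtration (Set.Icc (0 : ℝ) T) m)
    (S : Set.Icc (0 : ℝ) T → Ω → ℝ) (t : Fin (N + 1) → Set.Icc (0 : ℝ) T) : Prop :=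
  (∀ i, Integrable (S (t i)) Q) ∧
    ∀ i j : Fin (N + 1), i ≤ j → Q[S (t j) - S (t i) | 𝓖 (t i)] =ᵐ[Q] 0

/-- The probability measures equivalent to `P`, with finite entropy relative to `P`, under which
`S` has the relaxed martingale property at the times `t 0, …, t N`. -/
def relaxedMartingaleMeasures (P : Measure Ω) (𝓖 : Filtration (Set.Icc (0 : ℝ) T) m)
    (S : Set.Icc (0 : ℝ) T → Ω → ℝ) (t : Fin (N + 1) → Set.Icc (0 : ℝ) T) :
    Set (Measure Ω) :=
  {Q | IsProbabilityMeasure Q ∧ Q ≪ P ∧ P ≪ Q ∧ InformationTheory.klDiv Q P ≠ ⊤ ∧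
    RelaxedMartingale Q 𝓖 S t}

/-- The random variable `F - (1 / λ) log (dQ/dP)`. -/
noncomputable def penalizedPayoff (P Q : Measure Ω) (lam : ℝ) (F : Ω → ℝ) (ω : Ω) : ℝ :=
  F ω - (1 / lam) * Real.log (Q.rnDeriv P ω).toReal

/-- The dual objective `E_Q[F - (1 / λ) log (dQ/dP)]`. -/
noncomputable def dualValue (P Q : Measure Ω) (lam : ℝ) (F : Ω → ℝ) : ℝ :=
  ∫ ω, penalizedPayoff P Q lam F ω ∂Q

end DelayedDuality

/-! Weak duality is Jensen's inequality under `Q` together with `E_Q[V] = 0`. Strategies are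
unbounded and `S` need not be adapted to the investor's filtration, so the second fact needs an
argument: `integrable_martingaleTransform` derives it from integrability of the losses alone, and
finiteness of the exponential functional supplies that integrability.

For the reverse inequality, weighting `P` by `exp (λ F)` gives a finite measure `μ` and removes the
claim: the task becomes minimizing `∫ exp (-V) dμ` over the linear space `L` of profits of bounded
strategies. Let `u` be the infimum. No minimizer is needed in `L`, only a limit of the densities
`exp (-V n)` along minimizing sequences. Since `(V + W) / 2` lies in `L`, the functions `exp (-V n /
2)` are Cauchy in `L²` (`exists_common_limit`). A quadratic penalty yields minimizing sequences with
approximate first-order conditions (`exists_penalized_minimizer`), which bound the entropies. An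
entropy bound and almost everywhere convergence suffice to pass to the limit in integrals against
variables with all exponential moments (`integral_mul_eq_of_tendsto_ae`).

The limit `Z` has mass `u`, annihilates `L` and satisfies `∫ Z log Z dμ ≤ 0`; a given relaxed
martingale measure forces `u > 0` and `Z > 0`. Then `Z / u` is the density of a relaxed martingale
measure whose dual value is at least `(1 / λ) log u`, hence at least the primal infimum, and weak
duality closes the circle. -/

namespace DelayedDuality

open Filter Topology Set

/-! ### Martingale transforms of increments that are not adapted. -/

section MartingaleTransform

variable {Ω : Type*} {m : MeasurableSpace Ω}

lemma integral_mul_condExp_of_bounded {Q : Measure Ω} [IsFiniteMeasure Q] {𝒢 : MeasurableSpace Ω}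
    (h𝒢 : 𝒢 ≤ m) {g D : Ω → ℝ} (hg : Measurable[𝒢] g) {K : ℝ} (hK : ∀ ω, |g ω| ≤ K)
    (hD : Integrable D Q) :
    ∫ ω, g ω * D ω ∂Q = ∫ ω, g ω * (Q[D | 𝒢]) ω ∂Q := by
  have h := condExp_stronglyMeasurable_mul_of_bound h𝒢 hg.stronglyMeasurable hD K
    (Eventually.of_forall hK)
  rw [← integral_condExp h𝒢]
  exact integral_congr_ae h

/-- If the increments have vanishing conditional expectations, then a martingale transform with
integrable negative part is integrable with vanishing expectation. The increments need not be
adapted. -/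
theorem integrable_martingaleTransform (Q : Measure Ω) [IsProbabilityMeasure Q] (n : ℕ)
    (𝒢 : Fin n → MeasurableSpace Ω) (hmono : Monotone 𝒢) (h𝒢 : ∀ i, 𝒢 i ≤ m)
    (γ D : Fin n → Ω → ℝ) (hγ : ∀ i, Measurable[𝒢 i] (γ i)) (hD : ∀ i, Integrable (D i) Q)
    (hcond : ∀ i, Q[D i | 𝒢 i] =ᵐ[Q] 0)
    (hneg : Integrable (fun ω => max (-∑ i, γ i ω * D i ω) 0) Q) :
    Integrable (fun ω => ∑ i, γ i ω * D i ω) Q ∧ ∫ ω, ∑ i, γ i ω * D i ω ∂Q = 0 := by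
  induction n with
  | zero => simp
  | succ n ih =>
    have hle : 𝒢 (Fin.last n) ≤ m := h𝒢 _
    have hγℓ : ∀ i, Measurable[𝒢 (Fin.last n)] (γ i) := fun i => (hγ i).mono (hmono (Fin.le_last i)) le_rfl
    set V : Ω → ℝ := fun ω => ∑ i, γ i ω * D i ω with hV
    -- The earlier increments need not be measurable for the last σ-algebra, so they are projected
    -- onto it. The tower property keeps their conditional expectations zero, and the last increment
    -- projects to zero: `W` has one term fewer, which feeds the induction.
    set E : Fin n → Ω → ℝ := fun i => Q[D i.castSucc | 𝒢 (Fin.last n)] with hE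
    set W : Ω → ℝ := fun ω => ∑ i : Fin n, γ i.castSucc ω * E i ω with hW
    have hWℓ : Measurable[𝒢 (Fin.last n)] W := by
      refine Finset.measurable_fun_sum _ fun i _ => ?_
      exact (hγℓ _).mul stronglyMeasurable_condExp.measurable
    set A : ℕ → Set Ω := fun k => {ω | ∀ i, |γ i ω| ≤ k} with hA
    have hAℓ : ∀ k, MeasurableSet[𝒢 (Fin.last n)] (A k) := fun k => by
      have : A k = ⋂ i, {ω | |γ i ω| ≤ k} := by ext; simp [hA]
      rw [this]
      refine MeasurableSet.iInter fun i => ?_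
      have h1 : Measurable[𝒢 (Fin.last n)] fun ω => |γ i ω| := measurable_norm.comp (hγℓ i)
      exact h1 measurableSet_Iic
    have hcover : AECover Q atTop A := by
      refine ⟨Eventually.of_forall fun ω => ?_, fun k => hle _ (hAℓ k)⟩
      obtain ⟨K, hK⟩ := exists_nat_ge (∑ i, |γ i ω|)
      filter_upwards [eventually_ge_atTop K] with k hk i
      have h1 : |γ i ω| ≤ ∑ i, |γ i ω| :=
        Finset.single_le_sum (f := fun i => |γ i ω|) (fun _ _ => abs_nonneg _) (Finset.mem_univ i)
      have h2 : (K : ℝ) ≤ k := by exact_mod_cast hk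
      linarith
    -- integration over sets on which the positions are bounded
    have hterm : ∀ (B : Set Ω) (k : ℕ), MeasurableSet[𝒢 (Fin.last n)] B → B ⊆ A k → ∀ i,
        Measurable[𝒢 (Fin.last n)] (B.indicator (γ i)) ∧ ∀ ω, |B.indicator (γ i) ω| ≤ k := by
      intro B k hB hBA i
      refine ⟨(hγℓ i).indicator hB, fun ω => ?_⟩
      by_cases hω : ω ∈ B
      · simpa [hω] using hBA hω i
      · simp [hω]
    have hind : ∀ (B : Set Ω) (f g : Ω → ℝ),
        B.indicator (fun ω => f ω * g ω) = fun ω => B.indicator f ω * g ω := by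
      intro B f g
      ext ω
      by_cases hω : ω ∈ B <;> simp [hω]
    have hint : ∀ (B : Set Ω) (k : ℕ), MeasurableSet[𝒢 (Fin.last n)] B → B ⊆ A k → ∀ i, ∀ G : Ω → ℝ,
        Integrable G Q → IntegrableOn (fun ω => γ i ω * G ω) B Q := by
      intro B k hB hBA i G hG
      rw [← integrable_indicator_iff (hle _ hB), hind]
      exact hG.bdd_mul (c := k) ((hterm B k hB hBA i).1.mono hle le_rfl).aestronglyMeasurable
        (Eventually.of_forall (hterm B k hB hBA i).2)
    have hVB : ∀ (B : Set Ω) (k : ℕ), MeasurableSet[𝒢 (Fin.last n)] B → B ⊆ A k → IntegrableOn V B Q :=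
      fun B k hB hBA => integrable_finsetSum _ fun i _ => hint B k hB hBA i _ (hD i)
    have hWB : ∀ (B : Set Ω) (k : ℕ), MeasurableSet[𝒢 (Fin.last n)] B → B ⊆ A k → IntegrableOn W B Q :=
      fun B k hB hBA => integrable_finsetSum _ fun i _ => hint B k hB hBA _ _ integrable_condExp
    have hVW : ∀ (B : Set Ω) (k : ℕ), MeasurableSet[𝒢 (Fin.last n)] B → B ⊆ A k →
        ∫ ω in B, V ω ∂Q = ∫ ω in B, W ω ∂Q := by
      intro B k hB hBA
      have key : ∀ i, ∫ ω in B, γ i ω * D i ω ∂Q = ∫ ω in B, γ i ω * (Q[D i | 𝒢 (Fin.last n)]) ω ∂Q := by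
        intro i
        rw [← integral_indicator (hle _ hB), ← integral_indicator (hle _ hB), hind, hind]
        exact integral_mul_condExp_of_bounded hle (hterm B k hB hBA i).1 (hterm B k hB hBA i).2
          (hD i)
      have hlast : ∫ ω in B, γ (Fin.last n) ω * (Q[D (Fin.last n) | 𝒢 (Fin.last n)]) ω ∂Q = 0 := by
        rw [integral_eq_zero_of_ae]
        filter_upwards [ae_restrict_of_ae (hcond (Fin.last n))] with ω hω
        simp [hω]
      simp only [hV, hW]
      rw [integral_finsetSum _ fun i _ => hint B k hB hBA i _ (hD i),
        integral_finsetSum _ fun i _ => hint B k hB hBA _ _ integrable_condExp,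
        Fin.sum_univ_castSucc, key (Fin.last n), hlast, add_zero]
      exact Finset.sum_congr rfl fun i _ => key _
    have hnegB : ∀ B, MeasurableSet[𝒢 (Fin.last n)] B → ∫ ω in B, max (-V ω) 0 ∂Q ≤ ∫ ω, max (-V ω) 0 ∂Q :=
      fun B hB => setIntegral_le_integral hneg (Eventually.of_forall fun _ => le_max_right _ _)
    have hWneg : Integrable (fun ω => max (-W ω) 0) Q := by
      refine hcover.integrable_of_integral_bounded_of_nonneg_ae (∫ ω, max (-V ω) 0 ∂Q)
        (fun k => ((hWB (A k) k (hAℓ k) le_rfl).neg.pos_part))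
        (Eventually.of_forall fun _ => le_max_right _ _) (Eventually.of_forall fun k => ?_)
      -- Since `B` belongs to the last σ-algebra, `V` and `W` have the same integral on it, so the
      -- losses of `W` are bounded by those of `V`.
      set B := A k ∩ {ω | W ω < 0} with hB
      have hBℓ : MeasurableSet[𝒢 (Fin.last n)] B := (hAℓ k).inter (hWℓ measurableSet_Iio)
      have h1 : ∫ ω in A k, max (-W ω) 0 ∂Q = ∫ ω in B, -W ω ∂Q := by
        rw [← integral_indicator (hle _ (hAℓ k)), ← integral_indicator (hle _ hBℓ)]
        congr 1
        ext ω
        by_cases h : ω ∈ A k <;> by_cases h' : W ω < 0 <;> simp [hB, h, h'] <;> linarith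
      rw [h1, integral_neg, ← hVW B k hBℓ inter_subset_left, ← integral_neg]
      refine le_trans ?_ (hnegB B hBℓ)
      exact integral_mono (hVB B k hBℓ inter_subset_left).neg hneg.restrict
        fun ω => le_max_left _ _
    obtain ⟨hWi, hW0⟩ := ih (fun i => 𝒢 i.castSucc) (fun i j hij => hmono (by simpa using hij))
      (fun i => h𝒢 _) (fun i => γ i.castSucc) E (fun i => hγ _) (fun i => integrable_condExp)
      (fun i => (condExp_condExp_of_le (hmono (Fin.le_last _)) hle).trans (hcond _)) hWneg
    -- `|V| = V + 2 V⁻`, and on `A k` the integral of `V` is that of `W`, which is integrable by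
    -- induction.
    have hVi : Integrable V Q := by
      refine hcover.integrable_of_integral_norm_bounded
        (∫ ω, |W ω| ∂Q + 2 * ∫ ω, max (-V ω) 0 ∂Q)
        (fun k => hVB (A k) k (hAℓ k) le_rfl) (Eventually.of_forall fun k => ?_)
      have h1 : ∀ ω, ‖V ω‖ = V ω + 2 * max (-V ω) 0 := by
        intro ω
        rw [Real.norm_eq_abs]
        rcases le_total 0 (V ω) with h | h
        · rw [abs_of_nonneg h, max_eq_right (by linarith)]; ring
        · rw [abs_of_nonpos h, max_eq_left (by linarith)]; ring
      simp_rw [h1]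
      rw [integral_add (hVB (A k) k (hAℓ k) le_rfl) (hneg.restrict.const_mul 2), integral_const_mul,
        hVW (A k) k (hAℓ k) le_rfl]
      have h2 : ∫ ω in A k, W ω ∂Q ≤ ∫ ω, |W ω| ∂Q :=
        (integral_mono hWi.restrict hWi.abs.restrict fun ω => le_abs_self _).trans
          (setIntegral_le_integral hWi.abs (Eventually.of_forall fun _ => abs_nonneg _))
      have h3 := hnegB (A k) (hAℓ k)
      linarith
    refine ⟨hVi, ?_⟩
    have h1 := hcover.integral_tendsto_of_countably_generated hVi
    have h2 := hcover.integral_tendsto_of_countably_generated hWi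
    rw [← hW0]
    exact tendsto_nhds_unique (h1.congr fun k => hVW (A k) k (hAℓ k) le_rfl) h2

end MartingaleTransform

/-! ### Entropy inequalities and passage to the limit. -/

section Entropy

open InformationTheory

variable {Ω : Type*} {m : MeasurableSpace Ω} {μ : Measure Ω}

/-- Young's inequality for the conjugate pair `klFun`, `exp - 1`. -/
lemma mul_le_klFun_add_exp {x : ℝ} (hx : 0 ≤ x) (y : ℝ) :
    x * y ≤ klFun x + (Real.exp y - 1) := by
  rcases hx.eq_or_lt with rfl | hx
  · simp [klFun_zero, Real.exp_nonneg]
  · have h1 := Real.add_one_le_exp (y - Real.log x)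
    rw [Real.exp_sub, Real.exp_log hx, le_div_iff₀ hx] at h1
    rw [klFun_apply]
    nlinarith

lemma exp_add_le_exp_two_mul_add (x y : ℝ) :
    Real.exp (x + y) ≤ Real.exp (2 * x) + Real.exp (2 * y) := by
  rcases le_total x y with h | h
  · have : Real.exp (x + y) ≤ Real.exp (2 * y) := Real.exp_le_exp.2 (by linarith)
    have := Real.exp_pos (2 * x)
    linarith
  · have : Real.exp (x + y) ≤ Real.exp (2 * x) := Real.exp_le_exp.2 (by linarith)
    have := Real.exp_pos (2 * y)
    linarith

/-- Young's inequality at `δ |W|`: one exponential moment of `W`, however small, pairs with finite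
entropy of `Z`. -/
lemma integrable_mul_of_klFun {Z W : Ω → ℝ} [IsFiniteMeasure μ] (hZm : AEStronglyMeasurable Z μ)
    (hZ : ∀ᵐ ω ∂μ, 0 ≤ Z ω) (hkl : Integrable (fun ω => klFun (Z ω)) μ)
    (hW : Measurable W) {δ : ℝ} (hδ : 0 < δ)
    (hexp : Integrable (fun ω => Real.exp (δ * |W ω|)) μ) :
    Integrable (fun ω => Z ω * W ω) μ := by
  have h := (hkl.add (hexp.sub (integrable_const 1))).const_mul δ⁻¹
  refine h.mono' (hZm.mul hW.aestronglyMeasurable) ?_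
  filter_upwards [hZ] with ω hω
  have h1 := mul_le_klFun_add_exp hω (δ * |W ω|)
  rw [Real.norm_eq_abs, abs_mul, abs_of_nonneg hω, le_inv_mul_iff₀ hδ]
  simp only [Pi.add_apply, Pi.sub_apply]
  linarith

/-- Fatou's lemma for real-valued integrals. -/
lemma integral_le_of_tendsto_ae {f : ℕ → Ω → ℝ} {g : Ω → ℝ} (hf : ∀ n, Integrable (f n) μ)
    (hf0 : ∀ n, ∀ᵐ ω ∂μ, 0 ≤ f n ω)
    (hlim : ∀ᵐ ω ∂μ, Tendsto (fun n => f n ω) atTop (𝓝 (g ω)))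
    {a : ℕ → ℝ} {b : ℝ} (ha : ∀ n, ∫ ω, f n ω ∂μ ≤ a n) (hab : Tendsto a atTop (𝓝 b)) :
    Integrable g μ ∧ ∫ ω, g ω ∂μ ≤ b := by
  have hg : AEStronglyMeasurable g μ := aestronglyMeasurable_of_tendsto_ae atTop (fun n => (hf n).1) hlim
  have hg0 : ∀ᵐ ω ∂μ, 0 ≤ g ω := by
    filter_upwards [hlim, ae_all_iff.2 hf0] with ω h1 h2
    exact ge_of_tendsto' h1 h2
  have hb : 0 ≤ b := ge_of_tendsto' hab fun n => (integral_nonneg_of_ae (hf0 n)).trans (ha n)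
  have key : ∫⁻ ω, ENNReal.ofReal (g ω) ∂μ ≤ ENNReal.ofReal b := by
    calc ∫⁻ ω, ENNReal.ofReal (g ω) ∂μ
        = ∫⁻ ω, liminf (fun n => ENNReal.ofReal (f n ω)) atTop ∂μ := by
          refine lintegral_congr_ae ?_
          filter_upwards [hlim] with ω h
          exact ((ENNReal.continuous_ofReal.tendsto _).comp h).liminf_eq.symm
      _ ≤ liminf (fun n => ∫⁻ ω, ENNReal.ofReal (f n ω) ∂μ) atTop :=
          lintegral_liminf_le' fun n => (hf n).1.aemeasurable.ennreal_ofReal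
      _ ≤ liminf (fun n => ENNReal.ofReal (a n)) atTop := by
          refine liminf_le_liminf (Eventually.of_forall fun n => ?_)
          rw [← ofReal_integral_eq_lintegral_ofReal (hf n) (hf0 n)]
          exact ENNReal.ofReal_le_ofReal (ha n)
      _ = ENNReal.ofReal b := ((ENNReal.continuous_ofReal.tendsto _).comp hab).liminf_eq
  have hgi : Integrable g μ := by
    refine ⟨hg, ?_⟩
    rw [hasFiniteIntegral_iff_ofReal hg0]
    exact key.trans_lt ENNReal.ofReal_lt_top
  refine ⟨hgi, ?_⟩
  rwa [← ofReal_integral_eq_lintegral_ofReal hgi hg0, ENNReal.ofReal_le_ofReal_iff hb] at key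

lemma integral_add_add_const_mul {f g h : Ω → ℝ} (hf : Integrable f μ) (hg : Integrable g μ)
    (hh : Integrable h μ) (c : ℝ) :
    ∫ ω, (f ω + g ω + c * h ω) ∂μ = ∫ ω, f ω ∂μ + ∫ ω, g ω ∂μ + c * ∫ ω, h ω ∂μ := by
  have hfg : Integrable (fun ω => f ω + g ω) μ := hf.add hg
  rw [integral_add hfg (hh.const_mul c), integral_add hf hg, integral_const_mul]

/-- A bound on the entropies makes densities converging almost everywhere converge weakly against
variables with all exponential moments. -/
theorem integral_mul_eq_of_tendsto_ae [IsFiniteMeasure μ] {Z : ℕ → Ω → ℝ} {Z' W : Ω → ℝ}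
    (hZm : ∀ n, Measurable (Z n)) (hZ : ∀ n ω, 0 ≤ Z n ω)
    (hlim : ∀ᵐ ω ∂μ, Tendsto (fun n => Z n ω) atTop (𝓝 (Z' ω)))
    (hkl : ∀ n, Integrable (fun ω => klFun (Z n ω)) μ) {C : ℝ}
    (hC : ∀ n, ∫ ω, klFun (Z n ω) ∂μ ≤ C) (hW : Measurable W)
    (hexp : ∀ c : ℝ, Integrable (fun ω => Real.exp (c * |W ω|)) μ) {w : ℝ}
    (hw : Tendsto (fun n => ∫ ω, Z n ω * W ω ∂μ) atTop (𝓝 w)) :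
    ∫ ω, Z' ω * W ω ∂μ = w := by
  have hkl' : Integrable (fun ω => klFun (Z' ω)) μ ∧ ∫ ω, klFun (Z' ω) ∂μ ≤ C := by
    refine integral_le_of_tendsto_ae hkl (fun n => Eventually.of_forall fun ω => klFun_nonneg (hZ n ω))
      ?_ hC tendsto_const_nhds
    filter_upwards [hlim] with ω h
    exact (continuous_klFun.tendsto _).comp h
  have hZ'm : AEStronglyMeasurable Z' μ :=
    aestronglyMeasurable_of_tendsto_ae atTop (fun n => (hZm n).aestronglyMeasurable) hlim
  have hZ' : ∀ᵐ ω ∂μ, 0 ≤ Z' ω := by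
    filter_upwards [hlim] with ω h1
    exact ge_of_tendsto' h1 fun n => hZ n ω
  have main : ∀ (W : Ω → ℝ), Measurable W →
      (∀ c : ℝ, Integrable (fun ω => Real.exp (c * |W ω|)) μ) → ∀ w : ℝ,
      Tendsto (fun n => ∫ ω, Z n ω * W ω ∂μ) atTop (𝓝 w) → ∫ ω, Z' ω * W ω ∂μ ≤ w := by
    intro W hW hexp w hw
    have hi : ∀ n, Integrable (fun ω => Z n ω * W ω) μ := fun n =>
      integrable_mul_of_klFun (hZm n).aestronglyMeasurable (Eventually.of_forall (hZ n)) (hkl n) hW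
        one_pos (hexp 1)
    have hi' : Integrable (fun ω => Z' ω * W ω) μ :=
      integrable_mul_of_klFun hZ'm hZ' hkl'.1 hW one_pos (hexp 1)
    -- By Young's inequality, adding `klFun (Z n)` and `exp (c |W|) - 1` to `c * (Z n * W)` makes it
    -- nonnegative, so Fatou applies. The exponential term cancels and the error `C` does not depend
    -- on `c`; large `c` makes it negligible.
    have hbound : ∀ c : ℝ, 0 < c → c * (∫ ω, Z' ω * W ω ∂μ - w) ≤ C := by
      intro c hc
      have he : Integrable (fun ω => Real.exp (c * |W ω|) - 1) μ :=
        (hexp c).sub (integrable_const 1)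
      have h := integral_le_of_tendsto_ae (μ := μ)
        (f := fun n ω => klFun (Z n ω) + (Real.exp (c * |W ω|) - 1) + c * (Z n ω * W ω))
        (g := fun ω => klFun (Z' ω) + (Real.exp (c * |W ω|) - 1) + c * (Z' ω * W ω))
        (a := fun n => C + ∫ ω, (Real.exp (c * |W ω|) - 1) ∂μ + c * ∫ ω, Z n ω * W ω ∂μ)
        (b := C + ∫ ω, (Real.exp (c * |W ω|) - 1) ∂μ + c * w)
        (fun n => ((hkl n).add he).add ((hi n).const_mul c))
        (fun n => Eventually.of_forall fun ω => ?_) ?_ (fun n => ?_) ?_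
      · have h2 := h.2
        rw [integral_add_add_const_mul hkl'.1 he hi'] at h2
        have h3 : 0 ≤ ∫ ω, klFun (Z' ω) ∂μ := by
          refine integral_nonneg_of_ae ?_
          filter_upwards [hZ'] with ω h using klFun_nonneg h
        linarith
      · have h1 := mul_le_klFun_add_exp (hZ n ω) (c * |W ω|)
        have h2 : -|W ω| ≤ W ω := neg_abs_le _
        have h3 : 0 ≤ c * Z n ω := mul_nonneg hc.le (hZ n ω)
        have h4 := mul_le_mul_of_nonneg_left h2 h3
        linarith
      · filter_upwards [hlim] with ω h
        exact (((continuous_klFun.tendsto _).comp h).add tendsto_const_nhds).add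
          ((h.mul_const _).const_mul c)
      · rw [integral_add_add_const_mul (hkl n) he (hi n)]
        linarith [hC n]
      · exact (hw.const_mul c).const_add _
    by_contra! hcon
    have hd : 0 < ∫ ω, Z' ω * W ω ∂μ - w := sub_pos.2 hcon
    have h := hbound ((|C| + 1) / (∫ ω, Z' ω * W ω ∂μ - w)) (by positivity)
    rw [div_mul_cancel₀ _ hd.ne'] at h
    linarith [le_abs_self C]
  refine le_antisymm (main W hW hexp w hw) ?_
  have h := main (fun ω => -W ω) hW.neg (by simpa using hexp) (-w) (by
    simpa [integral_neg] using hw.neg)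
  simp only [mul_neg, integral_neg] at h
  linarith

/-- Jensen's inequality in the form of the Gibbs variational principle. -/
lemma exp_integral_sub_le {Q : Measure Ω} [IsProbabilityMeasure Q] {X ℓ : Ω → ℝ} {A : ℝ}
    (hX : Integrable X Q) (hℓ : Integrable ℓ Q) (hA : 0 ≤ A)
    (h : ∫⁻ ω, ENNReal.ofReal (Real.exp (X ω - ℓ ω)) ∂Q ≤ ENNReal.ofReal A) :
    Real.exp (∫ ω, X ω ∂Q - ∫ ω, ℓ ω ∂Q) ≤ A := by
  have hm : AEStronglyMeasurable (fun ω => Real.exp (X ω - ℓ ω)) Q :=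
    Real.continuous_exp.comp_aestronglyMeasurable (hX.sub hℓ).1
  have hi : Integrable (fun ω => Real.exp (X ω - ℓ ω)) Q := by
    refine ⟨hm, ?_⟩
    rw [hasFiniteIntegral_iff_ofReal (Eventually.of_forall fun _ => Real.exp_nonneg _)]
    exact h.trans_lt ENNReal.ofReal_lt_top
  have hJ := convexOn_exp.map_integral_le (μ := Q) (f := fun ω => X ω - ℓ ω)
    Real.continuous_exp.continuousOn isClosed_univ (by simp) (hX.sub hℓ) hi
  rw [integral_sub hX hℓ] at hJ
  refine hJ.trans ?_
  rwa [← ofReal_integral_eq_lintegral_ofReal hi (Eventually.of_forall fun _ => Real.exp_nonneg _),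
    ENNReal.ofReal_le_ofReal_iff hA] at h

/-- With `ℓ` a log-density of `Q`, this turns an exponential moment under the reference measure into
an `L¹(Q)` bound, through `X⁺ ≤ exp (X - ℓ) + |ℓ|`. -/
lemma integrable_posPart_of_lintegral_exp_sub {Q : Measure Ω} {X ℓ : Ω → ℝ} {A : ℝ}
    (hX : AEStronglyMeasurable X Q) (hℓ : Integrable ℓ Q)
    (h : ∫⁻ ω, ENNReal.ofReal (Real.exp (X ω - ℓ ω)) ∂Q ≤ ENNReal.ofReal A) (hA : 0 ≤ A) :
    Integrable (fun ω => max (X ω) 0) Q ∧ ∫ ω, max (X ω) 0 ∂Q ≤ A + ∫ ω, |ℓ ω| ∂Q := by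
  have hm : AEStronglyMeasurable (fun ω => Real.exp (X ω - ℓ ω)) Q :=
    Real.continuous_exp.comp_aestronglyMeasurable (hX.sub hℓ.1)
  have hi : Integrable (fun ω => Real.exp (X ω - ℓ ω)) Q := by
    refine ⟨hm, ?_⟩
    rw [hasFiniteIntegral_iff_ofReal (Eventually.of_forall fun _ => Real.exp_nonneg _)]
    exact h.trans_lt ENNReal.ofReal_lt_top
  have hle : ∀ ω, max (X ω) 0 ≤ Real.exp (X ω - ℓ ω) + |ℓ ω| := by
    intro ω
    have h1 := Real.add_one_le_exp (X ω - ℓ ω)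
    have h2 := le_abs_self (ℓ ω)
    exact max_le (by linarith) (add_nonneg (Real.exp_nonneg _) (abs_nonneg _))
  have hmax : Integrable (fun ω => max (X ω) 0) Q := by
    refine (hi.add hℓ.abs).mono' (hX.sup aestronglyMeasurable_const) (Eventually.of_forall fun ω => ?_)
    rw [Real.norm_eq_abs, abs_of_nonneg (le_max_right _ _)]
    exact hle ω
  refine ⟨hmax, (integral_mono hmax (hi.add hℓ.abs) hle).trans ?_⟩
  simp only [Pi.add_apply]
  rw [integral_add hi hℓ.abs]
  rw [← ofReal_integral_eq_lintegral_ofReal hi (Eventually.of_forall fun _ => Real.exp_nonneg _),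
    ENNReal.ofReal_le_ofReal_iff hA] at h
  linarith

end Entropy

/-! ### Minimizing sequences of the exponential functional. -/

section ExponentialMinimization

open InformationTheory

variable {Ω : Type*} {m : MeasurableSpace Ω} {μ : Measure Ω}

lemma integrable_exp_mul_abs {L : Submodule ℝ (Ω → ℝ)}
    (hexp : ∀ V ∈ L, Integrable (fun ω => Real.exp (V ω)) μ) {V : Ω → ℝ}
    (hVL : V ∈ L) (hV : Measurable V) (c : ℝ) : Integrable (fun ω => Real.exp (c * |V ω|)) μ := by
  refine ((hexp _ (L.smul_mem c hVL)).add (hexp _ (L.smul_mem (-c) hVL))).mono'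
    (by fun_prop) (Eventually.of_forall fun ω => ?_)
  rw [Real.norm_eq_abs, abs_of_pos (Real.exp_pos _)]
  simp only [Pi.add_apply, Pi.smul_apply, smul_eq_mul]
  have h1 := Real.exp_pos (c * V ω)
  have h2 := Real.exp_pos (-c * V ω)
  rcases abs_choice (V ω) with h | h <;> rw [h]
  · linarith
  · rw [mul_neg, ← neg_mul]
    linarith

lemma integrable_exp_add_abs {V W : Ω → ℝ} (hV : Measurable V) (hW : Measurable W)
    (hVexp : ∀ c : ℝ, Integrable (fun ω => Real.exp (c * |V ω|)) μ)
    (hWexp : ∀ c : ℝ, Integrable (fun ω => Real.exp (c * |W ω|)) μ) (c d : ℝ) :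
    Integrable (fun ω => Real.exp (c * |V ω| + d * |W ω|)) μ := by
  refine ((hVexp (2 * c)).add (hWexp (2 * d))).mono' (by fun_prop) (Eventually.of_forall fun ω => ?_)
  rw [Real.norm_eq_abs, abs_of_pos (Real.exp_pos _)]
  simp only [Pi.add_apply, mul_assoc]
  exact exp_add_le_exp_two_mul_add _ _

lemma continuous_integral_exp {V W : Ω → ℝ} (hV : Measurable V) (hW : Measurable W)
    (hVexp : ∀ c : ℝ, Integrable (fun ω => Real.exp (c * |V ω|)) μ)
    (hWexp : ∀ c : ℝ, Integrable (fun ω => Real.exp (c * |W ω|)) μ) :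
    Continuous fun p : ℝ × ℝ => ∫ ω, Real.exp (-(p.1 * V ω + p.2 * W ω)) ∂μ := by
  refine continuous_iff_continuousAt.2 fun p => ?_
  set K := ‖p‖ + 1
  refine continuousAt_of_dominated (bound := fun ω => Real.exp (K * |V ω| + K * |W ω|))
    (Eventually.of_forall fun q => by fun_prop) ?_
    (integrable_exp_add_abs hV hW hVexp hWexp K K)
    (Eventually.of_forall fun ω => by fun_prop)
  filter_upwards [Metric.ball_mem_nhds p one_pos] with q hq
  refine Eventually.of_forall fun ω => ?_
  rw [Real.norm_eq_abs, abs_of_pos (Real.exp_pos _)]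
  have hqK : ‖q‖ ≤ K := by
    have h1 : ‖q - p‖ < 1 := by simpa [dist_eq_norm] using hq
    have h2 : ‖q‖ ≤ ‖q - p‖ + ‖p‖ := by simpa using norm_add_le (q - p) p
    linarith
  have h1 : |q.1| ≤ K := (norm_fst_le q).trans hqK
  have h2 : |q.2| ≤ K := (norm_snd_le q).trans hqK
  refine Real.exp_le_exp.2 ?_
  have h3 : -(q.1 * V ω) ≤ K * |V ω| :=
    (neg_le_abs _).trans (by rw [abs_mul]; gcongr)
  have h4 : -(q.2 * W ω) ≤ K * |W ω| :=
    (neg_le_abs _).trans (by rw [abs_mul]; gcongr)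
  linarith

lemma hasDerivAt_integral_exp {V D : Ω → ℝ} (hV : Measurable V) (hD : Measurable D)
    (hVexp : ∀ c : ℝ, Integrable (fun ω => Real.exp (c * |V ω|)) μ)
    (hDexp : ∀ c : ℝ, Integrable (fun ω => Real.exp (c * |D ω|)) μ) :
    HasDerivAt (fun s : ℝ => ∫ ω, Real.exp (-(V ω + s * D ω)) ∂μ)
      (-∫ ω, D ω * Real.exp (-V ω) ∂μ) 0 := by
  have h := hasDerivAt_integral_of_dominated_loc_of_deriv_le (μ := μ) (x₀ := (0 : ℝ))
    (s := Metric.ball 0 1)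
    (F := fun s ω => Real.exp (-(V ω + s * D ω)))
    (F' := fun s ω => Real.exp (-(V ω + s * D ω)) * (-D ω))
    (bound := fun ω => Real.exp (1 * |V ω| + 2 * |D ω|))
    (Metric.ball_mem_nhds _ one_pos) (Eventually.of_forall fun s => by fun_prop) ?_ (by fun_prop)
    (Eventually.of_forall fun ω s hs => ?_) (integrable_exp_add_abs hV hD hVexp hDexp 1 2)
    (Eventually.of_forall fun ω s hs => ?_)
  · refine h.2.congr_deriv ?_
    rw [← integral_neg]
    congr 1
    ext ω
    simp only [zero_mul, add_zero]
    ring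
  · refine (hVexp 1).mono' (by fun_prop) (Eventually.of_forall fun ω => ?_)
    rw [Real.norm_eq_abs, abs_of_pos (Real.exp_pos _)]
    exact Real.exp_le_exp.2 (by linarith [neg_abs_le (V ω)])
  · rw [norm_mul, norm_neg, Real.norm_eq_abs, abs_of_pos (Real.exp_pos _), Real.norm_eq_abs]
    have hs' : |s| ≤ 1 := by simpa using (Metric.mem_ball.1 hs).le
    have h1 : -(s * D ω) ≤ |D ω| := (neg_le_abs _).trans (by
      rw [abs_mul]; exact mul_le_of_le_one_left (abs_nonneg _) hs')
    have h2 : |D ω| ≤ Real.exp |D ω| := by linarith [Real.add_one_le_exp |D ω|]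
    calc _ ≤ Real.exp (|V ω| + |D ω|) * Real.exp |D ω| := by
          gcongr
          linarith [neg_abs_le (V ω)]
      _ = _ := by rw [← Real.exp_add]; ring_nf
  · have h1 : HasDerivAt (fun s : ℝ => -(V ω + s * D ω)) (-D ω) s := by
      simpa using (((hasDerivAt_id' s).mul_const (D ω)).const_add (V ω)).fun_neg
    exact h1.exp

/-- Minimizing the exponential functional with a quadratic penalty over the span of `V` and `W`
gives an almost optimal element at which the first-order conditions hold approximately. -/
lemma exists_penalized_minimizer {L : Submodule ℝ (Ω → ℝ)} (hLm : ∀ V ∈ L, Measurable V)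
    (hexp : ∀ V ∈ L, Integrable (fun ω => Real.exp (V ω)) μ) {V W : Ω → ℝ}
    (hVL : V ∈ L) (hWL : W ∈ L) {η : ℝ} (hη : 0 < η) :
    ∃ V' ∈ L, ∫ ω, Real.exp (-V' ω) ∂μ ≤ ∫ ω, Real.exp (-V ω) ∂μ + η ∧
      0 ≤ ∫ ω, V' ω * Real.exp (-V' ω) ∂μ ∧
      (∫ ω, W ω * Real.exp (-V' ω) ∂μ) ^ 2 ≤ 4 * η * (∫ ω, Real.exp (-V ω) ∂μ + η) := by
  have hV := hLm V hVL
  have hW := hLm W hWL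
  have hVe := integrable_exp_mul_abs hexp hVL hV
  have hWe := integrable_exp_mul_abs hexp hWL hW
  -- The penalty makes `φ` coercive, so a minimum exists on the plane even where the exponential
  -- functional alone attains none.
  set φ : ℝ × ℝ → ℝ := fun p =>
    ∫ ω, Real.exp (-(p.1 * V ω + p.2 * W ω)) ∂μ + η * (p.1 ^ 2 + p.2 ^ 2) with hφ
  have hφc : Continuous φ := (continuous_integral_exp hV hW hVe hWe).add (by fun_prop)
  have hG0 : ∀ X : Ω → ℝ, 0 ≤ ∫ ω, Real.exp (-X ω) ∂μ := fun X =>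
    integral_nonneg fun _ => Real.exp_nonneg _
  obtain ⟨⟨a, b⟩, hmin⟩ : ∃ p, ∀ q, φ p ≤ φ q := by
    refine hφc.exists_forall_le' (0, 0) ?_
    filter_upwards [(tendsto_norm_cocompact_atTop (E := ℝ × ℝ)).eventually_ge_atTop
      (1 + φ (0, 0) / η)] with q hq
    have h1 : 0 ≤ φ (0, 0) := add_nonneg (integral_nonneg fun _ => Real.exp_nonneg _) (by positivity)
    have h2 : ‖q‖ ≤ ‖q‖ ^ 2 := by nlinarith [div_nonneg h1 hη.le]
    have h3 : ‖q‖ ^ 2 ≤ q.1 ^ 2 + q.2 ^ 2 := by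
      rw [Prod.norm_def]
      rcases max_choice ‖q.1‖ ‖q.2‖ with h | h <;> rw [h, Real.norm_eq_abs, sq_abs] <;>
        nlinarith [sq_nonneg q.1, sq_nonneg q.2]
    have h4 : φ (0, 0) / η ≤ q.1 ^ 2 + q.2 ^ 2 := by linarith
    rw [div_le_iff₀ hη] at h4
    have h5 : 0 ≤ ∫ ω, Real.exp (-(q.1 * V ω + q.2 * W ω)) ∂μ :=
      integral_nonneg fun _ => Real.exp_nonneg _
    simp only [hφ] at h4 ⊢
    linarith
  set V' : Ω → ℝ := a • V + b • W with hV'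
  have hV'L : V' ∈ L := L.add_mem (L.smul_mem a hVL) (L.smul_mem b hWL)
  have hV'm := hLm V' hV'L
  have hV'e := integrable_exp_mul_abs hexp hV'L hV'm
  have hval : ∫ ω, Real.exp (-V' ω) ∂μ + η * (a ^ 2 + b ^ 2) ≤ ∫ ω, Real.exp (-V ω) ∂μ + η := by
    have := hmin (1, 0)
    simpa [hφ, hV'] using this
  -- Stationarity in an arbitrary direction. The direction `(a, b)` gives the sign of `∫ V' exp
  -- (-V')`; the direction `(0, 1)` gives `2 η b`, which is small because `hval` bounds `η b²`.
  have hstat : ∀ d₁ d₂ : ℝ,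
      ∫ ω, (d₁ • V + d₂ • W) ω * Real.exp (-V' ω) ∂μ = 2 * η * (a * d₁ + b * d₂) := by
    intro d₁ d₂
    set D : Ω → ℝ := d₁ • V + d₂ • W with hD
    have hDL : D ∈ L := L.add_mem (L.smul_mem d₁ hVL) (L.smul_mem d₂ hWL)
    have hDm := hLm D hDL
    have h1 := hasDerivAt_integral_exp hV'm hDm hV'e (integrable_exp_mul_abs hexp hDL hDm)
    have h2 : HasDerivAt (fun s : ℝ => η * ((a + s * d₁) ^ 2 + (b + s * d₂) ^ 2))
        (η * (2 * a * d₁ + 2 * b * d₂)) 0 := by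
      have h3 : ∀ x y : ℝ, HasDerivAt (fun s : ℝ => (x + s * y) ^ 2) (2 * x * y) 0 := by
        intro x y
        simpa using (((hasDerivAt_id' (0 : ℝ)).mul_const y).const_add x).fun_pow 2
      exact ((h3 a d₁).add (h3 b d₂)).const_mul η
    have h4 := h1.add h2
    have h5 : IsLocalMin ((fun s : ℝ => ∫ ω, Real.exp (-(V' ω + s * D ω)) ∂μ) +
        fun s : ℝ => η * ((a + s * d₁) ^ 2 + (b + s * d₂) ^ 2)) 0 := by
      refine Eventually.of_forall fun s => ?_
      have h6 := hmin (a + s * d₁, b + s * d₂)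
      have e1 : ∀ ω, V' ω + s * D ω = (a + s * d₁) * V ω + (b + s * d₂) * W ω := by
        intro ω
        simp only [hV', hD, Pi.add_apply, Pi.smul_apply, smul_eq_mul]
        ring
      have e2 : ∀ ω, V' ω = a * V ω + b * W ω := fun ω => by simp [hV']
      simp only [Pi.add_apply, e1, zero_mul, add_zero]
      exact h6
    have h7 := h5.hasDerivAt_eq_zero h4
    linarith
  refine ⟨V', hV'L, ?_, ?_, ?_⟩
  · have : 0 ≤ η * (a ^ 2 + b ^ 2) := by positivity
    linarith
  · rw [hstat a b]
    have : 0 ≤ η * (a ^ 2 + b ^ 2) := by positivity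
    linarith
  · have h1 := hstat 0 1
    simp only [zero_smul, one_smul, zero_add, mul_zero, mul_one] at h1
    rw [h1]
    have h2 : η * b ^ 2 ≤ ∫ ω, Real.exp (-V ω) ∂μ + η := by
      have := hG0 V'
      nlinarith [mul_nonneg hη.le (sq_nonneg a)]
    nlinarith

/-- All minimizing sequences of the exponential functional have the same limit. -/
lemma exists_common_limit {L : Submodule ℝ (Ω → ℝ)} (hLm : ∀ V ∈ L, Measurable V)
    (hexp : ∀ V ∈ L, Integrable (fun ω => Real.exp (V ω)) μ) {u : ℝ}
    (hu : ∀ V ∈ L, u ≤ ∫ ω, Real.exp (-V ω) ∂μ)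
    (hu' : ∀ δ > 0, ∃ V ∈ L, ∫ ω, Real.exp (-V ω) ∂μ < u + δ) :
    ∃ f : Ω → ℝ, AEStronglyMeasurable f μ ∧ ∀ V : ℕ → Ω → ℝ, (∀ n, V n ∈ L) →
      Tendsto (fun n => ∫ ω, Real.exp (-V n ω) ∂μ) atTop (𝓝 u) →
      ∃ ns : ℕ → ℕ, StrictMono ns ∧
        ∀ᵐ ω ∂μ, Tendsto (fun n => Real.exp (-V (ns n) ω / 2)) atTop (𝓝 (f ω)) := by
  have hmem : ∀ V ∈ L, MemLp (fun ω => Real.exp (-V ω / 2)) 2 μ := by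
    intro V hV
    have hVm := hLm V hV
    rw [memLp_two_iff_integrable_sq (by fun_prop)]
    refine (hexp _ (L.neg_mem hV)).congr (Eventually.of_forall fun ω => ?_)
    simp only [Pi.neg_apply]
    rw [← Real.exp_nat_mul]
    congr 1
    push_cast
    ring
  -- The inner product of `exp (-V / 2)` and `exp (-W / 2)` is the functional at the midpoint of `V`
  -- and `W`, hence at least `u`.
  have hdist : ∀ V (hV : V ∈ L) W (hW : W ∈ L),
      ‖(hmem V hV).toLp - (hmem W hW).toLp‖ ^ 2 ≤
        ∫ ω, Real.exp (-V ω) ∂μ + ∫ ω, Real.exp (-W ω) ∂μ - 2 * u := by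
    intro V hV W hW
    have hinner : ∀ V (hV : V ∈ L) W (hW : W ∈ L),
        inner ℝ (hmem V hV).toLp (hmem W hW).toLp = ∫ ω, Real.exp (-((2⁻¹ : ℝ) • (V + W)) ω) ∂μ := by
      intro V hV W hW
      rw [L2.inner_def]
      refine integral_congr_ae ?_
      filter_upwards [(hmem V hV).coeFn_toLp, (hmem W hW).coeFn_toLp] with ω h1 h2
      rw [h1, h2]
      simp only [RCLike.inner_apply, conj_trivial, Pi.smul_apply, Pi.add_apply, smul_eq_mul]
      rw [← Real.exp_add]
      congr 1
      ring
    have hself : ∀ V (hV : V ∈ L), ‖(hmem V hV).toLp‖ ^ 2 = ∫ ω, Real.exp (-V ω) ∂μ := by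
      intro V hV
      rw [← real_inner_self_eq_norm_sq, hinner V hV V hV]
      congr 1
      ext ω
      simp only [Pi.smul_apply, Pi.add_apply, smul_eq_mul]
      congr 1
      ring
    rw [norm_sub_sq_real, hself V hV, hself W hW, hinner V hV W hW]
    have := hu _ (L.smul_mem 2⁻¹ (L.add_mem hV hW))
    linarith
  have htend : ∀ n : ℕ, ∃ V ∈ L, ∫ ω, Real.exp (-V ω) ∂μ < u + 1 / ((n : ℝ) + 1) :=
    fun n => hu' _ (by positivity)
  choose B hBL hB using htend
  have hcauchy : CauchySeq fun n => (hmem (B n) (hBL n)).toLp := by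
    rw [Metric.cauchySeq_iff]
    intro e he
    obtain ⟨N, hN⟩ := exists_nat_one_div_lt (show (0 : ℝ) < e ^ 2 / 2 by positivity)
    refine ⟨N, fun j hj k hk => ?_⟩
    have hle : ∀ i ≥ N, 1 / ((i : ℝ) + 1) < e ^ 2 / 2 := fun i hi =>
      lt_of_le_of_lt (one_div_le_one_div_of_le (by positivity) (by
        have : (N : ℝ) ≤ i := by exact_mod_cast hi
        linarith)) hN
    rw [dist_eq_norm]
    refine lt_of_pow_lt_pow_left₀ 2 he.le ((hdist _ (hBL j) _ (hBL k)).trans_lt ?_)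
    linarith [hB j, hB k, hle j hj, hle k hk]
  obtain ⟨f, hf⟩ := cauchySeq_tendsto_of_complete hcauchy
  have hBt : Tendsto (fun n => ∫ ω, Real.exp (-B n ω) ∂μ) atTop (𝓝 u) := by
    refine tendsto_of_tendsto_of_tendsto_of_le_of_le tendsto_const_nhds ?_
      (fun n => hu _ (hBL n)) fun n => (hB n).le
    simpa using tendsto_one_div_add_atTop_nhds_zero_nat.const_add u
  refine ⟨f, Lp.aestronglyMeasurable f, fun V hVL hV => ?_⟩
  -- `hdist` also compares any minimizing sequence with the reference sequence `B`, so `f` does not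
  -- depend on the sequence.
  have hVf : Tendsto (fun n => (hmem (V n) (hVL n)).toLp) atTop (𝓝 f) := by
    have h0 : Tendsto (fun n => (hmem (V n) (hVL n)).toLp - (hmem (B n) (hBL n)).toLp) atTop
        (𝓝 0) := by
      rw [tendsto_zero_iff_norm_tendsto_zero]
      have h1 : Tendsto (fun n => ‖(hmem (V n) (hVL n)).toLp - (hmem (B n) (hBL n)).toLp‖ ^ 2)
          atTop (𝓝 0) := by
        refine tendsto_of_tendsto_of_tendsto_of_le_of_le tendsto_const_nhds ?_
          (fun n => sq_nonneg _) fun n => hdist _ (hVL n) _ (hBL n)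
        have := (hV.add hBt).sub_const (2 * u)
        convert this using 2
        ring
      have h2 := h1.sqrt
      simpa [Real.sqrt_sq (norm_nonneg _)] using h2
    simpa using h0.add hf
  obtain ⟨ns, hns, hlim⟩ := (tendstoInMeasure_of_tendsto_Lp hVf).exists_seq_tendsto_ae
  refine ⟨ns, hns, ?_⟩
  have hcoe := ae_all_iff.2 fun n => (hmem (V n) (hVL n)).coeFn_toLp
  filter_upwards [hlim, hcoe] with ω h1 h2
  exact h1.congr fun n => h2 (ns n)

end ExponentialMinimization

/-! ### The limiting density and its entropy. -/

section ExponentialDuality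

open InformationTheory

variable {Ω : Type*} {m : MeasurableSpace Ω} {μ : Measure Ω}

/-- The formula converts the condition `0 ≤ ∫ V exp (-V)` of the penalized minimizers into an
entropy bound. -/
lemma integral_klFun_exp_neg [IsFiniteMeasure μ] {V : Ω → ℝ} (hV : Measurable V)
    (hexp : ∀ c : ℝ, Integrable (fun ω => Real.exp (c * |V ω|)) μ) :
    Integrable (fun ω => klFun (Real.exp (-V ω))) μ ∧
      ∫ ω, klFun (Real.exp (-V ω)) ∂μ =
        μ.real univ - ∫ ω, Real.exp (-V ω) ∂μ - ∫ ω, V ω * Real.exp (-V ω) ∂μ := by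
  have h1 : Integrable (fun ω => Real.exp (-V ω)) μ := by
    refine (hexp 1).mono' (by fun_prop) (Eventually.of_forall fun ω => ?_)
    rw [Real.norm_eq_abs, abs_of_pos (Real.exp_pos _), one_mul]
    exact Real.exp_le_exp.2 (neg_le_abs _)
  have h2 : Integrable (fun ω => V ω * Real.exp (-V ω)) μ := by
    refine (hexp 2).mono' (by fun_prop) (Eventually.of_forall fun ω => ?_)
    rw [norm_mul, Real.norm_eq_abs, Real.norm_eq_abs, abs_of_pos (Real.exp_pos _), two_mul,
      Real.exp_add]
    gcongr
    · linarith [Real.add_one_le_exp |V ω|]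
    · exact neg_le_abs _
  have e : (fun ω => klFun (Real.exp (-V ω))) =
      fun ω => 1 - Real.exp (-V ω) - V ω * Real.exp (-V ω) := by
    ext ω
    rw [klFun_apply, Real.log_exp]
    ring
  have h3 : Integrable (fun ω => 1 - Real.exp (-V ω)) μ := (integrable_const 1).sub h1
  rw [e]
  refine ⟨h3.sub h2, ?_⟩
  rw [integral_sub h3 h2, integral_sub (integrable_const 1) h1]
  simp

/-- The sequence is adapted to a single test element `W`. This is enough, since all minimizing
sequences share their limit. -/
lemma exists_minimizing_sequence {L : Submodule ℝ (Ω → ℝ)} (hLm : ∀ V ∈ L, Measurable V)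
    (hexp : ∀ V ∈ L, Integrable (fun ω => Real.exp (V ω)) μ) {u : ℝ}
    (hu : ∀ V ∈ L, u ≤ ∫ ω, Real.exp (-V ω) ∂μ)
    (hu' : ∀ δ > 0, ∃ V ∈ L, ∫ ω, Real.exp (-V ω) ∂μ < u + δ) {W : Ω → ℝ} (hW : W ∈ L) :
    ∃ V : ℕ → Ω → ℝ, (∀ n, V n ∈ L) ∧
      Tendsto (fun n => ∫ ω, Real.exp (-V n ω) ∂μ) atTop (𝓝 u) ∧
      (∀ n, 0 ≤ ∫ ω, V n ω * Real.exp (-V n ω) ∂μ) ∧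
      Tendsto (fun n => ∫ ω, W ω * Real.exp (-V n ω) ∂μ) atTop (𝓝 0) := by
  set η : ℕ → ℝ := fun n => 1 / ((n : ℝ) + 1) with hη
  have hηpos : ∀ n, 0 < η n := fun n => by positivity
  have hη0 : Tendsto η atTop (𝓝 0) := tendsto_one_div_add_atTop_nhds_zero_nat
  choose B hBL hB using fun n => hu' (η n) (hηpos n)
  choose V hVL hV1 hV2 hV3 using fun n => exists_penalized_minimizer hLm hexp (hBL n) hW (hηpos n)
  refine ⟨V, hVL, ?_, hV2, ?_⟩
  · refine tendsto_of_tendsto_of_tendsto_of_le_of_le tendsto_const_nhds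
      (h := fun n => u + η n + η n) ?_ (fun n => hu _ (hVL n)) fun n => ?_
    · simpa using (hη0.const_add u).add hη0
    · linarith [hV1 n, hB n]
  · have h1 : Tendsto (fun n => (∫ ω, W ω * Real.exp (-V n ω) ∂μ) ^ 2) atTop (𝓝 0) := by
      refine tendsto_of_tendsto_of_tendsto_of_le_of_le tendsto_const_nhds
        (h := fun n => 4 * η n * (u + η n + η n)) ?_ (fun n => sq_nonneg _) fun n => ?_
      · simpa using (hη0.const_mul 4).mul ((hη0.const_add u).add hη0)
      · refine (hV3 n).trans ?_
        have h1 := hB n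
        have h2 := hηpos n
        refine mul_le_mul_of_nonneg_left ?_ (by linarith)
        linarith
    rw [tendsto_zero_iff_abs_tendsto_zero]
    simpa [Real.sqrt_sq_eq_abs, Function.comp_def] using h1.sqrt

/-- The densities `exp (-V n)` of a minimizing sequence of the exponential functional over `L`
converge to a strictly positive density that annihilates `L` and has the least possible entropy. -/
theorem exists_minimal_entropy_density [IsFiniteMeasure μ] {L : Submodule ℝ (Ω → ℝ)}
    (hLm : ∀ V ∈ L, Measurable V) (hexp : ∀ V ∈ L, Integrable (fun ω => Real.exp (V ω)) μ)
    {Q : Measure Ω} [IsProbabilityMeasure Q] (hQμ : Q ≪ μ) (hμQ : μ ≪ Q)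
    {ℓ : Ω → ℝ} (hℓ : Integrable ℓ Q)
    (hQ : ∀ X : Ω → ℝ, Measurable X → ∫⁻ ω, ENNReal.ofReal (Real.exp (X ω - ℓ ω)) ∂Q ≤
      ∫⁻ ω, ENNReal.ofReal (Real.exp (X ω)) ∂μ)
    (hQL : ∀ V ∈ L, Integrable V Q ∧ ∫ ω, V ω ∂Q = 0) :
    ∃ (u : ℝ) (Z : Ω → ℝ), 0 < u ∧ Measurable Z ∧ (∀ ω, 0 < Z ω) ∧
      Integrable Z μ ∧ ∫ ω, Z ω ∂μ = u ∧
      Integrable (fun ω => klFun (Z ω)) μ ∧ ∫ ω, Z ω * Real.log (Z ω) ∂μ ≤ 0 ∧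
      (∀ W ∈ L, ∫ ω, Z ω * W ω ∂μ = 0) ∧
      ∀ δ > 0, ∃ V ∈ L, ∫ ω, Real.exp (-V ω) ∂μ < u + δ := by
  have hQV : ∀ V ∈ L, ∫⁻ ω, ENNReal.ofReal (Real.exp (-V ω - ℓ ω)) ∂Q ≤
      ENNReal.ofReal (∫ ω, Real.exp (-V ω) ∂μ) := by
    intro V hV
    have hi : Integrable (fun ω => Real.exp (-V ω)) μ := hexp _ (L.neg_mem hV)
    rw [ofReal_integral_eq_lintegral_ofReal hi
      (Eventually.of_forall fun _ => Real.exp_nonneg _)]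
    exact hQ _ (hLm V hV).neg
  have hG0 : ∀ X : Ω → ℝ, 0 ≤ ∫ ω, Real.exp (-X ω) ∂μ := fun X =>
    integral_nonneg fun _ => Real.exp_nonneg _
  -- Jensen under `Q`, where `V` has mean zero. This lower bound is what makes `u` strictly
  -- positive.
  have hlow : ∀ V ∈ L, Real.exp (-∫ ω, ℓ ω ∂Q) ≤ ∫ ω, Real.exp (-V ω) ∂μ := by
    intro V hV
    have h := exp_integral_sub_le (X := fun ω => -V ω) (hQL V hV).1.neg hℓ (hG0 V) (hQV V hV)
    rwa [integral_neg, (hQL V hV).2, neg_zero, zero_sub] at h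
  set G : Set ℝ := (fun V : Ω → ℝ => ∫ ω, Real.exp (-V ω) ∂μ) '' L
  have hGne : G.Nonempty := ⟨_, 0, L.zero_mem, rfl⟩
  have hGbdd : BddBelow G := ⟨Real.exp (-∫ ω, ℓ ω ∂Q), by rintro _ ⟨V, hV, rfl⟩; exact hlow V hV⟩
  obtain ⟨u, hudef⟩ : ∃ u, u = sInf G := ⟨_, rfl⟩
  have hupos : 0 < u := by
    rw [hudef]
    refine (Real.exp_pos (-∫ ω, ℓ ω ∂Q)).trans_le (le_csInf hGne ?_)
    rintro _ ⟨V, hV, rfl⟩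
    exact hlow V hV
  have hu : ∀ V ∈ L, u ≤ ∫ ω, Real.exp (-V ω) ∂μ := fun V hV => by
    rw [hudef]
    exact csInf_le hGbdd ⟨V, hV, rfl⟩
  have hu' : ∀ δ > 0, ∃ V ∈ L, ∫ ω, Real.exp (-V ω) ∂μ < u + δ := by
    intro δ hδ
    obtain ⟨_, ⟨V, hV, rfl⟩, h⟩ := exists_lt_of_csInf_lt hGne (show sInf G < u + δ by linarith)
    exact ⟨V, hV, h⟩
  obtain ⟨f, hfm, hf⟩ := exists_common_limit hLm hexp hu hu'
  -- positivity of the limit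
  have hfne : ∀ᵐ ω ∂μ, f ω ≠ 0 := by
    refine hμQ.ae_le ?_
    obtain ⟨V, hVL, hVu, -, -⟩ := exists_minimizing_sequence hLm hexp hu hu' L.zero_mem
    obtain ⟨ns, hns, hlim⟩ := hf V hVL hVu
    have hVu' := hVu.comp hns.tendsto_atTop
    -- As `V` has `Q`-mean zero, its `L¹(Q)` norm is twice the mean of its negative part. By Fatou
    -- `|V (ns n)|` then has a finite liminf almost surely, whereas `f ω = 0` would force `V (ns n)
    -- ω → ∞`.
    have hbound : ∀ n, ∫⁻ ω, ENNReal.ofReal |V (ns n) ω| ∂Q ≤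
        ENNReal.ofReal (2 * (∫ ω, Real.exp (-V (ns n) ω) ∂μ + ∫ ω, |ℓ ω| ∂Q)) := by
      intro n
      obtain ⟨hi, h0⟩ := hQL _ (hVL (ns n))
      obtain ⟨h1, h2⟩ := integrable_posPart_of_lintegral_exp_sub
        (X := fun ω => -V (ns n) ω) hi.neg.1 hℓ (hQV _ (hVL (ns n))) (hG0 _)
      rw [← ofReal_integral_eq_lintegral_ofReal hi.abs (Eventually.of_forall fun _ => abs_nonneg _)]
      refine ENNReal.ofReal_le_ofReal ?_
      have e : ∀ ω, |V (ns n) ω| = V (ns n) ω + 2 * max (-V (ns n) ω) 0 := by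
        intro ω
        rcases le_total 0 (V (ns n) ω) with h | h
        · rw [abs_of_nonneg h, max_eq_right (by linarith)]; ring
        · rw [abs_of_nonpos h, max_eq_left (by linarith)]; ring
      simp_rw [e]
      rw [integral_add hi (h1.const_mul 2), integral_const_mul, h0, zero_add]
      gcongr
    have hfatou : ∫⁻ ω, liminf (fun n => ENNReal.ofReal |V (ns n) ω|) atTop ∂Q < ⊤ := by
      refine (lintegral_liminf_le fun n => ?_).trans_lt ?_
      · exact (hLm _ (hVL _)).abs.ennreal_ofReal
      · refine (liminf_le_liminf (Eventually.of_forall hbound)).trans_lt ?_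
        have h1 := (ENNReal.continuous_ofReal.tendsto _).comp
          ((hVu'.add_const (∫ ω, |ℓ ω| ∂Q)).const_mul 2)
        exact h1.liminf_eq.trans_lt ENNReal.ofReal_lt_top
    have hfin := ae_lt_top (Measurable.liminf fun n => (hLm _ (hVL _)).abs.ennreal_ofReal) hfatou.ne
    filter_upwards [hfin, hQμ.ae_le hlim] with ω h1 h2 h3
    rw [h3, Real.tendsto_exp_comp_nhds_zero] at h2
    have h4 : Tendsto (fun n => |V (ns n) ω|) atTop atTop := by
      have h5 := (tendsto_neg_atBot_atTop.comp h2).const_mul_atTop (show (0 : ℝ) < 2 by norm_num)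
      refine tendsto_atTop_mono (fun n => ?_) h5
      simp only [Function.comp]
      linarith [le_abs_self (V (ns n) ω)]
    have h6 := (ENNReal.tendsto_ofReal_atTop.comp h4).liminf_eq
    simp only [Function.comp_def] at h6
    exact h1.ne h6
  obtain ⟨g, hgm, hfg⟩ := hfm
  -- The densities converge to the square of the `L²` limit; the value `1` on a null set makes `Z`
  -- positive everywhere.
  set Z : Ω → ℝ := fun ω => if g ω = 0 then 1 else g ω ^ 2 with hZ
  have hZm : Measurable Z :=
    Measurable.ite (hgm.measurable (measurableSet_singleton 0)) measurable_const
      (hgm.measurable.pow_const 2)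
  have hZpos : ∀ ω, 0 < Z ω := by
    intro ω
    by_cases h : g ω = 0
    · simp [hZ, h]
    · simp only [hZ, h, if_false]
      positivity
  have hZf : ∀ᵐ ω ∂μ, Z ω = f ω ^ 2 := by
    filter_upwards [hfne, hfg] with ω h1 h2
    rw [h2] at h1 ⊢
    simp [hZ, h1]
  -- approximation of `Z`
  have happrox : ∀ W ∈ L, ∃ V : ℕ → Ω → ℝ, (∀ n, V n ∈ L) ∧
      Tendsto (fun n => ∫ ω, Real.exp (-V n ω) ∂μ) atTop (𝓝 u) ∧
      Tendsto (fun n => ∫ ω, Real.exp (-V n ω) * W ω ∂μ) atTop (𝓝 0) ∧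
      (∀ᵐ ω ∂μ, Tendsto (fun n => Real.exp (-V n ω)) atTop (𝓝 (Z ω))) ∧
      (∀ n, Integrable (fun ω => klFun (Real.exp (-V n ω))) μ) ∧
      ∀ n, ∫ ω, klFun (Real.exp (-V n ω)) ∂μ ≤ μ.real univ - u := by
    intro W hW
    obtain ⟨V, hVL, hVu, hV0, hVW⟩ := exists_minimizing_sequence hLm hexp hu hu' hW
    obtain ⟨ns, hns, hlim⟩ := hf V hVL hVu
    have hkl := fun n => integral_klFun_exp_neg (hLm _ (hVL (ns n)))
      (integrable_exp_mul_abs hexp (hVL (ns n)) (hLm _ (hVL (ns n))))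
    refine ⟨fun n => V (ns n), fun n => hVL _, hVu.comp hns.tendsto_atTop, ?_, ?_,
      fun n => (hkl n).1, fun n => ?_⟩
    · simp_rw [mul_comm (Real.exp _)]
      exact hVW.comp hns.tendsto_atTop
    · filter_upwards [hlim, hZf] with ω h1 h2
      rw [h2]
      refine (h1.pow 2).congr fun n => ?_
      rw [← Real.exp_nat_mul]
      congr 1
      push_cast
      ring
    · rw [(hkl n).2]
      linarith [hu _ (hVL (ns n)), hV0 (ns n)]
  have hZW : ∀ W ∈ L, ∫ ω, Z ω * W ω ∂μ = 0 := by
    intro W hW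
    obtain ⟨V, hVL, -, hVW, hlim, hkl, hC⟩ := happrox W hW
    exact integral_mul_eq_of_tendsto_ae (fun n => (hLm _ (hVL n)).neg.exp)
      (fun _ _ => Real.exp_nonneg _) hlim hkl hC (hLm W hW)
      (integrable_exp_mul_abs hexp hW (hLm W hW)) hVW
  obtain ⟨V, hVL, hVu, -, hlim, hkl, hC⟩ := happrox 0 L.zero_mem
  -- Testing against the constant `1`, which need not lie in `L`: no mass is lost in the limit.
  have hZu : ∫ ω, Z ω ∂μ = u := by
    simpa using integral_mul_eq_of_tendsto_ae (W := fun _ => 1) (fun n => (hLm _ (hVL n)).neg.exp)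
      (fun _ _ => Real.exp_nonneg _) hlim hkl hC measurable_const
      (fun c => integrable_const _) (w := u) (by simpa using hVu)
  obtain ⟨hklZ, hklZu⟩ := integral_le_of_tendsto_ae hkl
    (fun n => Eventually.of_forall fun ω => klFun_nonneg (Real.exp_nonneg _))
    (g := fun ω => klFun (Z ω)) (by
      filter_upwards [hlim] with ω h
      exact (continuous_klFun.tendsto _).comp h) hC tendsto_const_nhds
  have hZi : Integrable Z μ := by
    simpa using integrable_mul_of_klFun (W := fun _ => 1) hZm.aestronglyMeasurable
      (Eventually.of_forall fun ω => (hZpos ω).le) hklZ measurable_const one_pos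
      (integrable_const _)
  refine ⟨u, Z, hupos, hZm, hZpos, hZi, hZu, hklZ, ?_, hZW, hu'⟩
  -- The bound `∫ klFun Z ≤ μ(Ω) - u` and the mass `∫ Z = u` cancel exactly, leaving `∫ Z log Z ≤
  -- 0`.
  have e : ∀ ω, Z ω * Real.log (Z ω) = klFun (Z ω) + Z ω - 1 := fun ω => by
    rw [klFun_apply]
    ring
  have h1 : Integrable (fun ω => klFun (Z ω) + Z ω) μ := hklZ.add hZi
  simp_rw [e]
  rw [integral_sub h1 (integrable_const 1), integral_add hklZ hZi, hZu]
  simp only [integral_const, smul_eq_mul, mul_one]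
  linarith

end ExponentialDuality

/-! ### Absorbing the payoff into the reference measure. -/

section ChangeOfMeasure

open InformationTheory

variable {Ω : Type*} {m : MeasurableSpace Ω}

/-- Multiplying by `exp (-llr Q P)` undoes the density; only the part of `P` where `dQ/dP` vanishes
is lost. -/
lemma lintegral_exp_sub_llr_le {P Q : Measure Ω} [SigmaFinite P] [SigmaFinite Q] (hQP : Q ≪ P)
    {X : Ω → ℝ} (hX : Measurable X) :
    ∫⁻ ω, ENNReal.ofReal (Real.exp (X ω - llr Q P ω)) ∂Q ≤
      ∫⁻ ω, ENNReal.ofReal (Real.exp (X ω)) ∂P := by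
  have hm : Measurable fun ω => ENNReal.ofReal (Real.exp (X ω - llr Q P ω)) :=
    (hX.sub (measurable_llr Q P)).exp.ennreal_ofReal
  rw [← lintegral_rnDeriv_mul hQP hm.aemeasurable]
  refine lintegral_mono_ae ?_
  filter_upwards [Q.rnDeriv_lt_top P] with ω hω
  rcases eq_or_ne (Q.rnDeriv P ω) 0 with h | h
  · simp [h]
  · have hpos : 0 < (Q.rnDeriv P ω).toReal := ENNReal.toReal_pos h hω.ne
    rw [llr, Real.exp_sub, Real.exp_log hpos]
    nth_rewrite 1 [← ENNReal.ofReal_toReal hω.ne]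
    rw [← ENNReal.ofReal_mul hpos.le, mul_div_cancel₀ _ hpos.ne']

/-- The exponents `1 + ε` and `(1 + ε) / ε` are conjugate: `F` has a moment only slightly beyond
`λ`, and the other factor pays with a high exponential moment. -/
lemma exp_mul_exp_le {ε : ℝ} (hε : 0 < ε) (x y : ℝ) :
    Real.exp x * Real.exp y ≤ Real.exp ((1 + ε) * x) + Real.exp ((1 + ε) / ε * y) := by
  rw [← Real.exp_add]
  rcases le_total y (ε * x) with h | h
  · have h1 : Real.exp (x + y) ≤ Real.exp ((1 + ε) * x) := Real.exp_le_exp.2 (by linarith)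
    linarith [Real.exp_pos ((1 + ε) / ε * y)]
  · have h1 : x + y ≤ (1 + ε) / ε * y := by
      rw [div_mul_eq_mul_div, le_div_iff₀ hε]
      linarith
    have h2 := Real.exp_le_exp.2 h1
    linarith [Real.exp_pos ((1 + ε) * x)]

lemma integrable_exp_mul_of_rpow {P : Measure Ω} [IsFiniteMeasure P] {s : Ω → ℝ} (hs : Measurable s)
    {ε : ℝ} (hε : 0 < ε) (h : Integrable (fun ω => Real.exp (ε * |s ω| ^ (1 + ε))) P) (c : ℝ) :
    Integrable (fun ω => Real.exp (c * |s ω|)) P := by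
  -- The threshold solves `ε r ^ ε = |c|`; beyond it the superlinear exponent dominates the linear
  -- one.
  set r : ℝ := (|c| / ε) ^ (1 / ε) with hr
  refine (h.add (integrable_const (Real.exp (|c| * r)))).mono' (by fun_prop)
    (Eventually.of_forall fun ω => ?_)
  rw [Real.norm_eq_abs, abs_of_pos (Real.exp_pos _)]
  simp only [Pi.add_apply]
  have h0 : c * |s ω| ≤ |c| * |s ω| := mul_le_mul_of_nonneg_right (le_abs_self c) (abs_nonneg _)
  have hp := Real.exp_pos (ε * |s ω| ^ (1 + ε))
  have hp' := Real.exp_pos (|c| * r)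
  rcases le_total |s ω| r with hsr | hsr
  · have := Real.exp_le_exp.2 (h0.trans (mul_le_mul_of_nonneg_left hsr (abs_nonneg c)))
    linarith
  · have hr0 : 0 ≤ r := by positivity
    have h1 : |c| / ε ≤ |s ω| ^ ε := by
      have h2 := Real.rpow_le_rpow hr0 hsr hε.le
      rwa [hr, ← Real.rpow_mul (by positivity), one_div_mul_cancel hε.ne', Real.rpow_one] at h2
    have h2 : |c| * |s ω| ≤ ε * |s ω| ^ (1 + ε) := by
      rw [div_le_iff₀ hε] at h1
      rw [Real.rpow_one_add' (abs_nonneg _) (by positivity)]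
      nlinarith [mul_le_mul_of_nonneg_right h1 (abs_nonneg (s ω))]
    have := Real.exp_le_exp.2 (h0.trans h2)
    linarith

lemma integrable_exp_mul_sum_abs {P : Measure Ω} [IsFiniteMeasure P] {ι : Type*} (I : Finset ι)
    {X : ι → Ω → ℝ} (hX : ∀ i, Measurable (X i))
    (h : ∀ i, ∀ c : ℝ, Integrable (fun ω => Real.exp (c * |X i ω|)) P) :
    ∀ c : ℝ, Integrable (fun ω => Real.exp (c * ∑ i ∈ I, |X i ω|)) P := by
  classical
  induction I using Finset.induction_on with
  | empty => simp
  | insert i I hi ih =>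
    have habs : ∀ ω, abs (∑ i ∈ I, |X i ω|) = ∑ i ∈ I, |X i ω| := fun ω =>
      abs_of_nonneg (Finset.sum_nonneg fun _ _ => abs_nonneg _)
    intro c
    have h1 := integrable_exp_add_abs (hX i) (W := fun ω => ∑ i ∈ I, |X i ω|) (by fun_prop)
      (h i) (by simpa only [habs] using ih) c c
    refine h1.congr (Eventually.of_forall fun ω => ?_)
    simp only [habs, Finset.sum_insert hi, mul_add]

/-- The measure with density `exp (λ F)` with respect to `P`. -/
noncomputable def expWeighted (P : Measure Ω) (lam : ℝ) (F : Ω → ℝ) : Measure Ω :=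
  P.withDensity fun ω => ENNReal.ofReal (Real.exp (lam * F ω))

section ExpWeighted

variable {P : Measure Ω} {lam : ℝ} {F : Ω → ℝ}

lemma integrable_expWeighted_iff (hF : Measurable F) {g : Ω → ℝ} :
    Integrable g (expWeighted P lam F) ↔ Integrable (fun ω => g ω * Real.exp (lam * F ω)) P := by
  rw [expWeighted, integrable_withDensity_iff (by fun_prop) (by simp)]
  simp only [ENNReal.toReal_ofReal (Real.exp_nonneg _)]

lemma lintegral_expWeighted (hF : Measurable F) {X : Ω → ℝ} (hX : Measurable X) :
    ∫⁻ ω, ENNReal.ofReal (Real.exp (X ω)) ∂(expWeighted P lam F) =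
      ∫⁻ ω, ENNReal.ofReal (Real.exp (X ω + lam * F ω)) ∂P := by
  rw [expWeighted, lintegral_withDensity_eq_lintegral_mul _ (by fun_prop) (by fun_prop)]
  refine lintegral_congr fun ω => ?_
  rw [Pi.mul_apply, ← ENNReal.ofReal_mul (Real.exp_nonneg _), ← Real.exp_add, add_comm]

lemma expWeighted_absolutelyContinuous : expWeighted P lam F ≪ P :=
  withDensity_absolutelyContinuous _ _

lemma absolutelyContinuous_expWeighted (hF : Measurable F) : P ≪ expWeighted P lam F := by
  refine withDensity_absolutelyContinuous' (by fun_prop) (Eventually.of_forall fun ω => ?_)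
  simpa using Real.exp_pos _

variable {ε : ℝ}

lemma integrable_exp_expWeighted (hF : Measurable F) (hlam : 0 < lam) (hε : 0 < ε)
    (hFexp : Integrable (fun ω => Real.exp (lam * (1 + ε) * |F ω|)) P) {X : Ω → ℝ}
    (hX : Measurable X) (hXexp : Integrable (fun ω => Real.exp ((1 + ε) / ε * X ω)) P) :
    Integrable (fun ω => Real.exp (X ω)) (expWeighted P lam F) := by
  rw [integrable_expWeighted_iff hF]
  refine (hFexp.add hXexp).mono' (by fun_prop) (Eventually.of_forall fun ω => ?_)
  rw [Real.norm_eq_abs, abs_of_pos (by positivity), mul_comm]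
  refine (exp_mul_exp_le hε _ _).trans ?_
  have h := mul_le_mul_of_nonneg_left (le_abs_self (F ω))
    (mul_nonneg hlam.le (by linarith : 0 ≤ 1 + ε))
  simp only [Pi.add_apply]
  refine add_le_add (Real.exp_le_exp.2 ?_) le_rfl
  linarith

lemma integrable_exp_abs_expWeighted (hF : Measurable F) (hlam : 0 < lam)
    (hFexp : Integrable (fun ω => Real.exp (lam * (1 + ε) * |F ω|)) P) :
    Integrable (fun ω => Real.exp (lam * ε * |F ω|)) (expWeighted P lam F) := by
  rw [integrable_expWeighted_iff hF]
  refine hFexp.mono' (by fun_prop) (Eventually.of_forall fun ω => ?_)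
  rw [Real.norm_eq_abs, abs_of_pos (by positivity), ← Real.exp_add]
  refine Real.exp_le_exp.2 ?_
  nlinarith [mul_le_mul_of_nonneg_left (le_abs_self (F ω)) hlam.le]

lemma isFiniteMeasure_expWeighted [IsFiniteMeasure P] (hF : Measurable F) (hlam : 0 < lam)
    (hε : 0 < ε) (hFexp : Integrable (fun ω => Real.exp (lam * (1 + ε) * |F ω|)) P) :
    IsFiniteMeasure (expWeighted P lam F) := by
  have h := integrable_exp_expWeighted hF hlam hε hFexp (X := fun _ => 0) measurable_const
    (integrable_const _)
  simp only [Real.exp_zero] at h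
  rcases integrable_const_iff.1 h with h | h
  · exact absurd h one_ne_zero
  · exact h

end ExpWeighted

end ChangeOfMeasure

/-! ### Strategies, relaxed martingale measures and weak duality. -/

section Market

open InformationTheory

variable {Ω : Type*} {m : MeasurableSpace Ω} {T : ℝ} {N : ℕ}
  {𝓖 : Filtration (Set.Icc (0 : ℝ) T) m} {S : Set.Icc (0 : ℝ) T → Ω → ℝ}
  {t : Fin (N + 1) → Set.Icc (0 : ℝ) T}

/-- The linear space of profits and losses of the bounded strategies. -/
def boundedPnL (𝓖 : Filtration (Set.Icc (0 : ℝ) T) m) (S : Set.Icc (0 : ℝ) T → Ω → ℝ)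
    (t : Fin (N + 1) → Set.Icc (0 : ℝ) T) : Submodule ℝ (Ω → ℝ) where
  carrier := {V | ∃ γ ∈ strategies 𝓖 t, (∃ K : ℝ, ∀ i ω, |γ i ω| ≤ K) ∧ terminalPnL S t γ = V}
  add_mem' := by
    rintro _ _ ⟨γ, hγ, ⟨K, hK⟩, rfl⟩ ⟨γ', hγ', ⟨K', hK'⟩, rfl⟩
    refine ⟨fun i => γ i + γ' i, fun i => (hγ i).add (hγ' i), ⟨K + K', fun i ω => ?_⟩, ?_⟩
    · exact (abs_add_le _ _).trans (add_le_add (hK i ω) (hK' i ω))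
    · ext ω
      simp only [terminalPnL, Pi.add_apply, add_mul, Finset.sum_add_distrib]
  zero_mem' := by
    refine ⟨fun _ _ => 0, fun i => measurable_const, ⟨0, by simp⟩, ?_⟩
    ext ω
    simp [terminalPnL]
  smul_mem' := by
    rintro c _ ⟨γ, hγ, ⟨K, hK⟩, rfl⟩
    refine ⟨fun i => c • γ i, fun i => (hγ i).const_smul c, ⟨|c| * K, fun i ω => ?_⟩, ?_⟩
    · change |c * γ i ω| ≤ _
      rw [abs_mul]
      exact mul_le_mul_of_nonneg_left (hK i ω) (abs_nonneg c)
    · ext ω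
      simp only [terminalPnL, Pi.smul_apply, smul_eq_mul, Finset.mul_sum, mul_assoc]

lemma measurable_terminalPnL (hS : ∀ i, Measurable (S (t i))) {γ : Fin N → Ω → ℝ}
    (hγ : γ ∈ strategies 𝓖 t) : Measurable (terminalPnL S t γ) := by
  refine Finset.measurable_fun_sum _ fun i _ => ?_
  exact ((hγ i).mono (𝓖.le _) le_rfl).mul ((hS _).sub (hS _))

lemma measurable_of_mem_boundedPnL (hS : ∀ i, Measurable (S (t i))) {V : Ω → ℝ}
    (hV : V ∈ boundedPnL 𝓖 S t) : Measurable V := by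
  obtain ⟨γ, hγ, -, rfl⟩ := hV
  exact measurable_terminalPnL hS hγ

lemma exists_le_sum_of_mem_boundedPnL {V : Ω → ℝ} (hV : V ∈ boundedPnL 𝓖 S t) :
    ∃ K : ℝ, ∀ ω, V ω ≤ K * ∑ i, |S (t i) ω| := by
  obtain ⟨γ, hγ, ⟨K, hK⟩, rfl⟩ := hV
  refine ⟨|K| * 2, fun ω => ?_⟩
  have h1 : ∑ i : Fin N, |S (t i.succ) ω| ≤ ∑ i, |S (t i) ω| := by
    rw [Fin.sum_univ_succ]
    linarith [abs_nonneg (S (t 0) ω)]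
  have h2 : ∑ i : Fin N, |S (t i.castSucc) ω| ≤ ∑ i, |S (t i) ω| := by
    rw [Fin.sum_univ_castSucc]
    linarith [abs_nonneg (S (t (Fin.last N)) ω)]
  calc terminalPnL S t γ ω
      ≤ ∑ i : Fin N, |K| * (|S (t i.succ) ω| + |S (t i.castSucc) ω|) := by
        refine Finset.sum_le_sum fun i _ => (le_abs_self _).trans ?_
        rw [abs_mul]
        exact mul_le_mul ((hK i ω).trans (le_abs_self K)) (abs_sub _ _) (abs_nonneg _)
          (abs_nonneg _)
    _ = |K| * (∑ i : Fin N, |S (t i.succ) ω| + ∑ i : Fin N, |S (t i.castSucc) ω|) := by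
        rw [← Finset.sum_add_distrib, Finset.mul_sum]
    _ ≤ |K| * 2 * ∑ i, |S (t i) ω| := by
        rw [mul_assoc]
        refine mul_le_mul_of_nonneg_left ?_ (abs_nonneg K)
        linarith

/-- Under a relaxed martingale measure, a strategy with integrable losses has vanishing expected
profit. -/
lemma RelaxedMartingale.integral_terminalPnL {Q : Measure Ω} [IsProbabilityMeasure Q]
    (hQ : RelaxedMartingale Q 𝓖 S t) (ht : StrictMono t) {γ : Fin N → Ω → ℝ}
    (hγ : γ ∈ strategies 𝓖 t) (hneg : Integrable (fun ω => max (-terminalPnL S t γ ω) 0) Q) :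
    Integrable (terminalPnL S t γ) Q ∧ ∫ ω, terminalPnL S t γ ω ∂Q = 0 :=
  integrable_martingaleTransform Q N (fun i => 𝓖 (t i.castSucc))
    (fun i j hij => 𝓖.mono (ht.monotone (by simpa using hij))) (fun i => 𝓖.le _) γ
    (fun i => S (t i.succ) - S (t i.castSucc)) hγ (fun i => (hQ.1 _).sub (hQ.1 _))
    (fun i => hQ.2 _ _ (Fin.castSucc_lt_succ).le) hneg

lemma RelaxedMartingale.integral_eq_zero_of_mem_boundedPnL {Q : Measure Ω} [IsProbabilityMeasure Q]
    (hQ : RelaxedMartingale Q 𝓖 S t) (ht : StrictMono t) {V : Ω → ℝ}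
    (hV : V ∈ boundedPnL 𝓖 S t) : Integrable V Q ∧ ∫ ω, V ω ∂Q = 0 := by
  obtain ⟨γ, hγ, ⟨K, hK⟩, rfl⟩ := hV
  refine hQ.integral_terminalPnL ht hγ (Integrable.pos_part (Integrable.neg ?_))
  refine integrable_finsetSum _ fun i _ => ?_
  exact ((hQ.1 i.succ).sub (hQ.1 i.castSucc)).bdd_mul (c := K)
    ((hγ i).mono (𝓖.le _) le_rfl).aestronglyMeasurable (Eventually.of_forall (hK i))

lemma relaxedMartingale_of_integral_eq_zero {Q : Measure Ω} [IsProbabilityMeasure Q]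
    (hSi : ∀ i, Integrable (S (t i)) Q) (ht : StrictMono t)
    (h : ∀ V ∈ boundedPnL 𝓖 S t, ∫ ω, V ω ∂Q = 0) : RelaxedMartingale Q 𝓖 S t := by
  refine ⟨hSi, fun i j hij => ?_⟩
  have hstep : ∀ (k : Fin N) (A : Set Ω), MeasurableSet[𝓖 (t k.castSucc)] A →
      ∫ ω in A, (S (t k.succ) ω - S (t k.castSucc) ω) ∂Q = 0 := by
    intro k A hA
    rw [← integral_indicator (𝓖.le _ A hA)]
    -- Test strategy: hold one unit over a single interval, on the event `A`. Longer intervals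
    -- follow by telescoping, as `A` stays in the later σ-algebras.
    refine h _ ⟨Pi.single k (A.indicator 1), fun l => ?_, ⟨1, fun l ω => ?_⟩, ?_⟩
    · rcases eq_or_ne l k with rfl | hl
      · rw [Pi.single_eq_same]
        exact measurable_const.indicator hA
      · rw [Pi.single_eq_of_ne hl]
        exact measurable_const
    · rcases eq_or_ne l k with rfl | hl
      · rw [Pi.single_eq_same]
        by_cases hω : ω ∈ A <;> simp [hω]
      · simp [Pi.single_eq_of_ne hl]
    · ext ω
      rw [terminalPnL, Finset.sum_eq_single k (fun l _ hl => by simp [Pi.single_eq_of_ne hl])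
        (by simp), Pi.single_eq_same]
      by_cases hω : ω ∈ A <;> simp [hω]
  have hset : ∀ A, MeasurableSet[𝓖 (t i)] A → ∀ j, i ≤ j →
      ∫ ω in A, (S (t j) ω - S (t i) ω) ∂Q = 0 := by
    intro A hA j
    induction j using Fin.induction with
    | zero =>
      intro hj
      rw [Fin.le_zero_iff.1 hj]
      simp
    | succ k ih =>
      intro hj
      rcases hj.eq_or_lt with rfl | hlt
      · simp
      · have hik : i ≤ k.castSucc := Fin.le_castSucc_iff.2 hlt
        have h1 := hstep k A (𝓖.mono (ht.monotone hik) A hA)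
        have h2 := ih hik
        have e : ∀ ω, S (t k.succ) ω - S (t i) ω =
            (S (t k.succ) ω - S (t k.castSucc) ω) + (S (t k.castSucc) ω - S (t i) ω) := fun ω => by
          ring
        have hi : ∀ a b, Integrable (fun ω => S (t a) ω - S (t b) ω) (Q.restrict A) := fun a b =>
          ((hSi a).sub (hSi b)).restrict
        simp_rw [e]
        rw [integral_add (hi _ _) (hi _ _), h1, h2, add_zero]
  refine (ae_eq_condExp_of_forall_setIntegral_eq (𝓖.le _) ((hSi j).sub (hSi i))
    (fun _ _ _ => integrableOn_zero) (fun A hA _ => ?_) aestronglyMeasurable_zero).symm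
  simp only [Pi.sub_apply, integral_zero]
  exact (hset A hA j hij).symm

variable {P : Measure Ω} {lam : ℝ} {F : Ω → ℝ} {ε : ℝ}

lemma integrable_payoff [IsProbabilityMeasure P] (hF : Measurable F) (hlam : 0 < lam) (hε : 0 < ε)
    (hFexp : Integrable (fun ω => Real.exp (lam * (1 + ε) * |F ω|)) P) {Q : Measure Ω}
    (hQ : Q ∈ relaxedMartingaleMeasures P 𝓖 S t) : Integrable F Q := by
  obtain ⟨_, hQP, -, hkl, -⟩ := hQ
  have hexp : Integrable (fun ω => Real.exp (lam * |F ω|)) P := by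
    refine hFexp.mono' (by fun_prop) (Eventually.of_forall fun ω => ?_)
    rw [Real.norm_eq_abs, abs_of_pos (Real.exp_pos _)]
    refine Real.exp_le_exp.2 ?_
    nlinarith [mul_nonneg (mul_nonneg hlam.le hε.le) (abs_nonneg (F ω))]
  have h := lintegral_exp_sub_llr_le hQP (X := fun ω => lam * |F ω|) (by fun_prop)
  rw [← ofReal_integral_eq_lintegral_ofReal hexp
    (Eventually.of_forall fun _ => Real.exp_nonneg _)] at h
  have h1 := (integrable_posPart_of_lintegral_exp_sub (X := fun ω => lam * |F ω|)
    (by fun_prop) (klDiv_ne_top_iff.1 hkl).2 h (integral_nonneg fun _ => Real.exp_nonneg _)).1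
  refine (h1.const_mul lam⁻¹).mono' hF.aestronglyMeasurable (Eventually.of_forall fun ω => ?_)
  rw [Real.norm_eq_abs, max_eq_left (by positivity), inv_mul_cancel_left₀ hlam.ne']

lemma integrable_penalizedPayoff {Q : Measure Ω} (hFQ : Integrable F Q)
    (hQ : Q ∈ relaxedMartingaleMeasures P 𝓖 S t) [IsFiniteMeasure P] :
    Integrable (penalizedPayoff P Q lam F) Q := by
  obtain ⟨_, -, -, hkl, -⟩ := hQ
  exact hFQ.sub ((klDiv_ne_top_iff.1 hkl).2.const_mul (1 / lam))

/-- Weak duality. -/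
lemma dualValue_le_certaintyEquivalent [IsProbabilityMeasure P] (hS : ∀ i, Measurable (S (t i)))
    (hF : Measurable F) (ht : StrictMono t) (hlam : 0 < lam) {Q : Measure Ω}
    (hQ : Q ∈ relaxedMartingaleMeasures P 𝓖 S t) (hFQ : Integrable F Q) {γ : Fin N → Ω → ℝ}
    (hγ : γ ∈ strategies 𝓖 t) :
    ((dualValue P Q lam F : ℝ) : EReal) ≤ certaintyEquivalent P lam (terminalPnL S t γ) F := by
  obtain ⟨_, hQP, -, hkl, hmart⟩ := hQ
  have hllr : Integrable (llr Q P) Q := (klDiv_ne_top_iff.1 hkl).2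
  set V := terminalPnL S t γ with hV
  have hVm : Measurable V := measurable_terminalPnL hS hγ
  have hXm : Measurable fun ω => -lam * (V ω - F ω) := by fun_prop
  rw [certaintyEquivalent]
  by_cases htop : ∫⁻ ω, ENNReal.ofReal (Real.exp (-lam * (V ω - F ω))) ∂P = ⊤
  · rw [htop, ENNReal.log_top, EReal.coe_mul_top_of_pos (by positivity)]
    exact le_top
  set A := (∫⁻ ω, ENNReal.ofReal (Real.exp (-lam * (V ω - F ω))) ∂P).toReal with hA
  have hAeq : ∫⁻ ω, ENNReal.ofReal (Real.exp (-lam * (V ω - F ω))) ∂P = ENNReal.ofReal A :=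
    (ENNReal.ofReal_toReal htop).symm
  have h := lintegral_exp_sub_llr_le hQP hXm
  rw [hAeq] at h
  have hpos := (integrable_posPart_of_lintegral_exp_sub hXm.aestronglyMeasurable hllr h
    ENNReal.toReal_nonneg).1
  -- Finite exponential utility controls the losses under `Q`; this is the hypothesis under which an
  -- unbounded strategy has zero expected profit.
  have hneg : Integrable (fun ω => max (-V ω) 0) Q := by
    refine ((hpos.const_mul lam⁻¹).add hFQ.abs).mono' (by fun_prop) (Eventually.of_forall fun ω => ?_)
    rw [Real.norm_eq_abs, abs_of_nonneg (le_max_right _ _)]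
    simp only [Pi.add_apply]
    have h1 : -V ω + F ω ≤ lam⁻¹ * max (-lam * (V ω - F ω)) 0 := by
      rw [le_inv_mul_iff₀ hlam]
      exact le_trans (le_of_eq (by ring)) (le_max_left _ _)
    have h2 : 0 ≤ lam⁻¹ * max (-lam * (V ω - F ω)) 0 :=
      mul_nonneg (inv_nonneg.2 hlam.le) (le_max_right _ _)
    exact max_le (by linarith [neg_abs_le (F ω)]) (add_nonneg h2 (abs_nonneg _))
  obtain ⟨hVi, hV0⟩ := hmart.integral_terminalPnL ht hγ hneg
  have hJ := exp_integral_sub_le (X := fun ω => -lam * (V ω - F ω))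
    ((hVi.sub hFQ).const_mul (-lam)) hllr ENNReal.toReal_nonneg h
  have hApos : 0 < A := (Real.exp_pos _).trans_le hJ
  rw [integral_const_mul, integral_sub hVi hFQ, hV0, ← Real.le_log_iff_exp_le hApos] at hJ
  rw [hAeq, ENNReal.log_ofReal_of_pos hApos, ← EReal.coe_mul, EReal.coe_le_coe_iff]
  have hd : dualValue P Q lam F = ∫ ω, F ω ∂Q - 1 / lam * ∫ ω, llr Q P ω ∂Q := by
    rw [← integral_const_mul, ← integral_sub hFQ (hllr.const_mul _)]
    rfl
  have h3 : lam * (∫ ω, F ω ∂Q) - ∫ ω, llr Q P ω ∂Q ≤ Real.log A := by linarith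
  have h4 := mul_le_mul_of_nonneg_left h3 (by positivity : 0 ≤ 1 / lam)
  have h5 : 1 / lam * (lam * (∫ ω, F ω ∂Q) - ∫ ω, llr Q P ω ∂Q) =
      ∫ ω, F ω ∂Q - 1 / lam * ∫ ω, llr Q P ω ∂Q := by
    field_simp
  rw [hd, ← h5]
  exact h4

end Market

/-! ### Construction of the dual optimizer. -/

section Optimizer

open InformationTheory

variable {Ω : Type*} {m : MeasurableSpace Ω} {T : ℝ} {N : ℕ}
  {𝓖 : Filtration (Set.Icc (0 : ℝ) T) m} {S : Set.Icc (0 : ℝ) T → Ω → ℝ}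
  {t : Fin (N + 1) → Set.Icc (0 : ℝ) T} {P : Measure Ω} {lam : ℝ} {F : Ω → ℝ} {ε : ℝ}

/-- There is a relaxed martingale measure whose dual value dominates the primal infimum. -/
theorem exists_iInf_le_dualValue [IsProbabilityMeasure P] (hS : ∀ i, Measurable (S (t i)))
    (hF : Measurable F) (ht : StrictMono t) (hlam : 0 < lam) (hε : 0 < ε)
    (hFexp : Integrable (fun ω => Real.exp (lam * (1 + ε) * |F ω|)) P)
    (hSexp : ∀ i, Integrable (fun ω => Real.exp (ε * |S (t i) ω| ^ (1 + ε))) P)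
    (hne : (relaxedMartingaleMeasures P 𝓖 S t).Nonempty) :
    ∃ Q₀ ∈ relaxedMartingaleMeasures P 𝓖 S t,
      (⨅ γ ∈ strategies 𝓖 t, certaintyEquivalent P lam (terminalPnL S t γ) F) ≤
        ((dualValue P Q₀ lam F : ℝ) : EReal) := by
  obtain ⟨Q, hQ⟩ := hne
  have hFQ : Integrable F Q := integrable_payoff hF hlam hε hFexp hQ
  obtain ⟨_, hQP, hPQ, hkl, hmart⟩ := hQ
  set μ := expWeighted P lam F with hμ
  have : IsFiniteMeasure μ := isFiniteMeasure_expWeighted hF hlam hε hFexp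
  have hPμ : P ≪ μ := absolutelyContinuous_expWeighted hF
  have hμP : μ ≪ P := expWeighted_absolutelyContinuous
  have hSabs := integrable_exp_mul_sum_abs (P := P) Finset.univ (X := fun i => S (t i)) hS
    fun i => integrable_exp_mul_of_rpow (hS i) hε (hSexp i)
  have hLm : ∀ V ∈ boundedPnL 𝓖 S t, Measurable V := fun V => measurable_of_mem_boundedPnL hS
  have hLexp : ∀ V ∈ boundedPnL 𝓖 S t, Integrable (fun ω => Real.exp (V ω)) μ := by
    intro V hV
    have hVm := hLm V hV
    obtain ⟨K, hK⟩ := exists_le_sum_of_mem_boundedPnL hV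
    refine integrable_exp_expWeighted hF hlam hε hFexp hVm ?_
    refine (hSabs ((1 + ε) / ε * K)).mono' (by fun_prop) (Eventually.of_forall fun ω => ?_)
    rw [Real.norm_eq_abs, abs_of_pos (Real.exp_pos _), mul_assoc]
    exact Real.exp_le_exp.2 (mul_le_mul_of_nonneg_left (hK ω) (by positivity))
  obtain ⟨u, Z, hu, hZm, hZpos, hZi, hZu, hklZ, hent, hZL, happrox⟩ :=
    exists_minimal_entropy_density hLm hLexp (hQP.trans hPμ) (hμP.trans hPQ)
      -- This is the logarithm of `dQ/dμ`.
      (ℓ := fun ω => llr Q P ω - lam * F ω)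
      ((klDiv_ne_top_iff.1 hkl).2.sub (hFQ.const_mul lam))
      (fun X hX => by
        have h := lintegral_exp_sub_llr_le hQP (X := fun ω => X ω + lam * F ω) (by fun_prop)
        rw [lintegral_expWeighted hF hX]
        refine le_of_eq_of_le (lintegral_congr fun ω => ?_) h
        congr 2
        ring)
      (fun V hV => hmart.integral_eq_zero_of_mem_boundedPnL ht hV)
  have hdm : Measurable fun ω => ENNReal.ofReal (Z ω / u) := by fun_prop
  set Q₀ := μ.withDensity fun ω => ENNReal.ofReal (Z ω / u) with hQ₀
  have hdens : ∀ ω, 0 < Z ω / u := fun ω => div_pos (hZpos ω) hu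
  have hprob : IsProbabilityMeasure Q₀ := by
    refine ⟨?_⟩
    rw [hQ₀, withDensity_apply _ MeasurableSet.univ, Measure.restrict_univ,
      ← ofReal_integral_eq_lintegral_ofReal (hZi.div_const u)
        (Eventually.of_forall fun ω => (hdens ω).le), integral_div, hZu, div_self hu.ne',
      ENNReal.ofReal_one]
  have hQ₀μ : Q₀ ≪ μ := withDensity_absolutelyContinuous _ _
  have hμQ₀ : μ ≪ Q₀ := withDensity_absolutelyContinuous' hdm.aemeasurable
    (Eventually.of_forall fun ω => by simpa using hdens ω)
  have hint : ∀ g : Ω → ℝ, Integrable (fun ω => Z ω * g ω) μ → Integrable g Q₀ := by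
    intro g hg
    rw [hQ₀, integrable_withDensity_iff hdm (by simp)]
    refine (hg.div_const u).congr (Eventually.of_forall fun ω => ?_)
    simp only [ENNReal.toReal_ofReal (hdens ω).le]
    ring
  have hintegral : ∀ g : Ω → ℝ, ∫ ω, g ω ∂Q₀ = (∫ ω, Z ω * g ω ∂μ) / u := by
    intro g
    rw [hQ₀, integral_withDensity_eq_integral_toReal_smul hdm (by simp), ← integral_div]
    congr 1
    ext ω
    simp only [ENNReal.toReal_ofReal (hdens ω).le, smul_eq_mul]
    ring
  have hZ0 : ∀ᵐ ω ∂μ, 0 ≤ Z ω := Eventually.of_forall fun ω => (hZpos ω).le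
  have hSQ₀ : ∀ i, Integrable (S (t i)) Q₀ := fun i => hint _ <| by
    refine integrable_mul_of_klFun hZm.aestronglyMeasurable hZ0 hklZ (hS i) one_pos ?_
    refine integrable_exp_expWeighted hF hlam hε hFexp (X := fun ω => 1 * |S (t i) ω|)
      (by have := hS i; fun_prop) ?_
    simpa using integrable_exp_mul_of_rpow (hS i) hε (hSexp i) ((1 + ε) / ε)
  have hFQ₀ : Integrable F Q₀ := hint _ <|
    integrable_mul_of_klFun hZm.aestronglyMeasurable hZ0 hklZ hF (mul_pos hlam hε)
      (integrable_exp_abs_expWeighted hF hlam hFexp)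
  have hZlog : Integrable (fun ω => Z ω * Real.log (Z ω)) μ := by
    refine ((hklZ.add hZi).sub (integrable_const 1)).congr (Eventually.of_forall fun ω => ?_)
    simp only [Pi.add_apply, Pi.sub_apply, klFun_apply]
    ring
  have hlogQ₀ : Integrable (fun ω => Real.log (Z ω)) Q₀ := hint _ hZlog
  have hllr : llr Q₀ P =ᵐ[P] fun ω => lam * F ω + (Real.log (Z ω) - Real.log u) := by
    have e : Q₀ = P.withDensity
        ((fun ω => ENNReal.ofReal (Real.exp (lam * F ω))) * fun ω => ENNReal.ofReal (Z ω / u)) := by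
      rw [hQ₀, hμ, expWeighted, withDensity_mul _ (by fun_prop) hdm]
    rw [e]
    filter_upwards [Measure.rnDeriv_withDensity P (f := (fun ω =>
      ENNReal.ofReal (Real.exp (lam * F ω))) * fun ω => ENNReal.ofReal (Z ω / u)) (by fun_prop)]
      with ω hω
    rw [llr, hω, Pi.mul_apply, ENNReal.toReal_mul, ENNReal.toReal_ofReal (Real.exp_nonneg _),
      ENNReal.toReal_ofReal (hdens ω).le, Real.log_mul (Real.exp_pos _).ne' (hdens ω).ne',
      Real.log_exp, Real.log_div (hZpos ω).ne' hu.ne']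
  have hllr' : llr Q₀ P =ᵐ[Q₀] fun ω => lam * F ω + (Real.log (Z ω) - Real.log u) :=
    (hQ₀μ.trans hμP).ae_le hllr
  have hklQ₀ : klDiv Q₀ P ≠ ⊤ := klDiv_ne_top (hQ₀μ.trans hμP)
    (((hFQ₀.const_mul lam).add (hlogQ₀.sub (integrable_const (Real.log u)))).congr hllr'.symm)
  refine ⟨Q₀, ⟨hprob, hQ₀μ.trans hμP, hPμ.trans hμQ₀, hklQ₀,
    relaxedMartingale_of_integral_eq_zero hSQ₀ ht fun V hV => ?_⟩, ?_⟩
  · rw [hintegral, hZL V hV, zero_div]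
  -- `F` cancels against its share of `log (dQ₀/dP)`, leaving `(1 / λ) (log u - E[log Z])` under
  -- `Q₀`, and `E[log Z] = (∫ Z log Z dμ) / u ≤ 0`.
  have hdual : 1 / lam * Real.log u ≤ dualValue P Q₀ lam F := by
    have e : dualValue P Q₀ lam F = ∫ ω, 1 / lam * (Real.log u - Real.log (Z ω)) ∂Q₀ := by
      refine integral_congr_ae ?_
      filter_upwards [hllr'] with ω hω
      rw [llr] at hω
      rw [penalizedPayoff, hω]
      field_simp
      ring
    rw [e, integral_const_mul, integral_sub (integrable_const _) hlogQ₀, integral_const,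
      probReal_univ, one_smul, hintegral]
    refine mul_le_mul_of_nonneg_left ?_ (by positivity)
    have := div_nonpos_of_nonpos_of_nonneg hent hu.le
    linarith
  refine le_trans ?_ (EReal.coe_le_coe_iff.2 hdual)
  have hle : ∀ n : ℕ, (⨅ γ ∈ strategies 𝓖 t, certaintyEquivalent P lam (terminalPnL S t γ) F) ≤
      ((1 / lam * Real.log (u + 1 / ((n : ℝ) + 1)) : ℝ) : EReal) := by
    intro n
    obtain ⟨V, hV, hVu⟩ := happrox (1 / ((n : ℝ) + 1)) (by positivity)
    -- The minimization over `L` carries no factor `λ`, so near-optimal profits are rescaled before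
    -- they are traded.
    obtain ⟨γ, hγ, -, hγV⟩ := (boundedPnL 𝓖 S t).smul_mem lam⁻¹ hV
    refine (iInf₂_le γ hγ).trans ?_
    rw [certaintyEquivalent, EReal.coe_mul, ← ENNReal.log_ofReal_of_pos (by positivity)]
    refine mul_le_mul_of_nonneg_left (ENNReal.log_le_log ?_)
      (EReal.coe_nonneg.2 (by positivity))
    have hVi : Integrable (fun ω => Real.exp (-V ω)) μ :=
      hLexp _ ((boundedPnL 𝓖 S t).neg_mem hV)
    refine le_trans (le_of_eq ?_) (ENNReal.ofReal_le_ofReal hVu.le)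
    rw [ofReal_integral_eq_lintegral_ofReal hVi (Eventually.of_forall fun _ => Real.exp_nonneg _),
      lintegral_expWeighted hF (X := fun ω => -V ω) (hLm V hV).neg]
    refine lintegral_congr fun ω => ?_
    rw [hγV, Pi.smul_apply, smul_eq_mul]
    congr 2
    field_simp
    ring
  have h1 : Tendsto (fun n : ℕ => u + 1 / ((n : ℝ) + 1)) atTop (𝓝 u) := by
    simpa using tendsto_one_div_add_atTop_nhds_zero_nat.const_add u
  exact ge_of_tendsto' (EReal.tendsto_coe.2 ((h1.log hu.ne').const_mul (1 / lam))) hle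

end Optimizer

end DelayedDuality

theorem mainTheorem3 {Ω : Type*} {m : MeasurableSpace Ω} (P : Measure Ω) [IsProbabilityMeasure P]
    (T : ℝ)
    -- the market filtration and the investor's (smaller) filtration
    (𝓕 𝓖 : Filtration (Set.Icc (0 : ℝ) T) m) (h𝓖 : 𝓖 ≤ 𝓕)
    -- the price process and the payoff
    (S : Set.Icc (0 : ℝ) T → Ω → ℝ) (hS : Adapted 𝓕 S) (F : Ω → ℝ) (hF : Measurable F)
    -- the trading times
    (N : ℕ) (t : Fin (N + 1) → Set.Icc (0 : ℝ) T) (ht : StrictMono t) (ht0 : (t 0 : ℝ) = 0)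
    -- the risk aversion and the exponential moment conditions
    (lam : ℝ) (hlam : 0 < lam) (ε : ℝ) (hε : 0 < ε)
    (hFexp : Integrable (fun ω => Real.exp (lam * (1 + ε) * |F ω|)) P)
    (hSexp : ∀ i, Integrable (fun ω => Real.exp (ε * |S (t i) ω| ^ (1 + ε))) P)
    -- absence of arbitrage in the relaxed sense
    (hne : (DelayedDuality.relaxedMartingaleMeasures P 𝓖 S t).Nonempty) :
    -- the dual objective is well defined
    (∀ Q ∈ DelayedDuality.relaxedMartingaleMeasures P 𝓖 S t,
      Integrable (DelayedDuality.penalizedPayoff P Q lam F) Q) ∧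
    -- there is no duality gap
    (⨅ γ ∈ DelayedDuality.strategies 𝓖 t,
        DelayedDuality.certaintyEquivalent P lam (DelayedDuality.terminalPnL S t γ) F) =
      (⨆ Q ∈ DelayedDuality.relaxedMartingaleMeasures P 𝓖 S t,
        ((DelayedDuality.dualValue P Q lam F : ℝ) : EReal)) ∧
    -- the supremum is attained
    ∃ Q₀ ∈ DelayedDuality.relaxedMartingaleMeasures P 𝓖 S t,
      ((DelayedDuality.dualValue P Q₀ lam F : ℝ) : EReal) =
        ⨆ Q ∈ DelayedDuality.relaxedMartingaleMeasures P 𝓖 S t,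
          ((DelayedDuality.dualValue P Q lam F : ℝ) : EReal) := by
  have hSm : ∀ i, Measurable (S (t i)) := fun i => (hS (t i)).mono (𝓕.le _) le_rfl
  have hFQ := fun Q hQ => DelayedDuality.integrable_payoff (𝓖 := 𝓖) (S := S) (t := t) (Q := Q)
    hF hlam hε hFexp hQ
  obtain ⟨Q₀, hQ₀, hle⟩ :=
    DelayedDuality.exists_iInf_le_dualValue hSm hF ht hlam hε hFexp hSexp hne
  have hweak : (⨆ Q ∈ DelayedDuality.relaxedMartingaleMeasures P 𝓖 S t,
      ((DelayedDuality.dualValue P Q lam F : ℝ) : EReal)) ≤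
      ⨅ γ ∈ DelayedDuality.strategies 𝓖 t,
        DelayedDuality.certaintyEquivalent P lam (DelayedDuality.terminalPnL S t γ) F :=
    iSup₂_le fun Q hQ => le_iInf₂ fun γ hγ =>
      DelayedDuality.dualValue_le_certaintyEquivalent hSm hF ht hlam hQ (hFQ Q hQ) hγ
  have hsup : ((DelayedDuality.dualValue P Q₀ lam F : ℝ) : EReal) ≤
      ⨆ Q ∈ DelayedDuality.relaxedMartingaleMeasures P 𝓖 S t,
        ((DelayedDuality.dualValue P Q lam F : ℝ) : EReal) :=
    le_iSup₂ (f := fun Q _ => ((DelayedDuality.dualValue P Q lam F : ℝ) : EReal)) Q₀ hQ₀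
  -- Infimum ≤ dual value of `Q₀` ≤ supremum ≤ infimum, so all are equal.
  exact ⟨fun Q hQ => DelayedDuality.integrable_penalizedPayoff (hFQ Q hQ) hQ,
    le_antisymm (hle.trans hsup) hweak, Q₀, hQ₀, le_antisymm hsup (hweak.trans hle)⟩
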